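/- All functions are complex valued. For $\xi\in\mathbb R^N$ let $e_\xi(y)=e^{i\xi\cdot y}$ and let $\mathrm{Trig}(\mathbb R^N)$ be the complex span of the $e_\xi$; $CAP(\mathbb R^N)$ is its closure for uniform convergence, and $\mathcal B^2(\mathbb R^N)$ is the space of functions $u\in L^2_{loc}(\mathbb R^N)$ such that for every $\delta>0$ there is $p\in \mathrm{Trig}(\mathbb R^N)$ with $\limsup_{n}\frac1{|B(0,n)|}\int_{B(0,n)}|u-p|^2\,dy<\delta$, with the seminorm $\big(\limsup_n\frac1{|B(0,n)|}\int_{B(0,n)}|u|^2dy\big)^{1/2}$ (functions at distance $0$ are identified). $M(u)$ denotes the mean value of $u$, i.e. $M(u)=\lim_{n\to\infty}\frac1{|n\omega|}\int_{n\omega}u\,dy$ for every bounded measurable $\omega\subset\mathbb R^N$ with $|\omega|>0$. An element of $\mathcal B^2(\mathbb R^N)$ is identified with the formal series $\sum_\xi a_\xi e^{i\xi\cdot y}$, $a_\xi=M(e^{-i\xi\cdot y}u)$, and derivatives are taken on the formal series: $\partial_{y_j}\sum_\xi a_\xi e^{i\xi\cdot y}=i\sum_\xi\xi_j a_\xi e^{i\xi\cdot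 y}$. Given $\varepsilon_n>0$, $\varepsilon_n\to0$, and $\Omega\subset\mathbb R^N$ open, a sequence $u_n\in L^2(\Omega)$ two-scale converges to $\hat u\in L^2(\Omega;\mathcal B^2(\mathbb R^N))$ in $\Omega$ if for every $\psi\in C^0_c(\Omega;CAP(\mathbb R^N))$ $$\lim_{n\to\infty}\int_\Omega u_n(x)\,\psi\big(x,\tfrac{x}{\varepsilon_n}\big)\,dx=\int_\Omega M\big(\hat u(x,\cdot)\psi(x,\cdot)\big)\,dx .$$ **Proposition.** Let $T>0$, let $\varepsilon_n>0$ with $\varepsilon_n\to 0$, and let $P\in L^\infty(\mathbb R^3)^{3\times3}$ be periodic with period the unit cube, hermitian, and such that $P(y)\eta\cdot\overline\eta\ge\alpha|\eta|^2$ for some $\alpha>0$, all $\eta\in\mathbb C^3$ and a.e. $y\in\mathbb R^3$. Let $f_n,g_n$ be bounded in $L^2((0,T)\times\mathbb R^3)^3$ and $B^0_n,E^0_n$ be bounded in $L^2(\mathbb R^3)^3$, and assume that the distributional divergences satisfy $$\mathrm{div}_xf_n,\ \mathrm{div}_xg_n\ \text{ bounded in } L^2((0,T)\times\mathbb R^3),\qquad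 \mathrm{div}_x\big(P\big(\tfrac{x}{\varepsilon_n}\big)E^0_n\big),\ \mathrm{div}_xB^0_n\ \text{ bounded in } L^2(\mathbb R^3).$$ Let $\hat f,\hat g\in L^2((0,T)\times\mathbb R^3;\mathcal B^2(\mathbb R^4))^3$ and $\hat B^0,\hat E^0\in L^2(\mathbb R^3;\mathcal B^2(\mathbb R^3))^3$ be such that, componentwise, $f_n,g_n$ two-scale converge to $\hat f,\hat g$ in $(0,T)\times\mathbb R^3$ (with fast variables $(s,y)\in\mathbb R\times\mathbb R^3$) and $B^0_n,E^0_n$ two-scale converge to $\hat B^0,\hat E^0$ in $\mathbb R^3$ (with fast variable $y\in\mathbb R^3$). Then $$\mathrm{div}_y\hat f=\mathrm{div}_y\hat g=0\ \text{ for a.e. }(t,x)\in(0,T)\times\mathbb R^3,$$ and, for a.e. $x\in\mathbb R^3$, $P\hat E^0(x,\cdot)\in\mathcal B^2(\mathbb R^3)^3$ and $$\mathrm{div}_y\hat B^0=\mathrm{div}_y\big(P\hat E^0\big)=0 .$$ -/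

import Mathlib

open MeasureTheory Filter Topology Set
open scoped ENNReal NNReal Pointwise BoundedContinuousFunction

noncomputable section

namespace TwoScaleMaxwell

/-- `ℝ^N` with its Euclidean norm. -/
abbrev Euc (N : ℕ) : Type := EuclideanSpace ℝ (Fin N)

/-! ### Trigonometric polynomials, Bohr and Besicovitch almost periodic functions -/

/-- `Trig(ℝ^N)`: the complex span of the functions `y ↦ e^{i ξ·y}`, `ξ ∈ ℝ^N`. -/
def trig (N : ℕ) : Submodule ℂ (Euc N →ᵇ ℂ) :=
  Submodule.span ℂ (Set.range fun ξ : Euc N => BoundedContinuousFunction.innerProbChar ξ)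

/-- `CAP(ℝ^N)`: the closure of `Trig(ℝ^N)` for uniform convergence. -/
def bohrAP (N : ℕ) : Submodule ℂ (Euc N →ᵇ ℂ) := (trig N).topologicalClosure

/-- The upper quadratic mean `limsup_n |B(0,n)|⁻¹ ∫_{B(0,n)} |u|² dy`. -/
def upperMeanSq {N : ℕ} (u : Euc N → ℂ) : ℝ≥0∞ :=
  limsup (fun n : ℕ => (volume (Metric.ball (0 : Euc N) n))⁻¹ *
    ∫⁻ y in Metric.ball (0 : Euc N) n, ‖u y‖ₑ ^ 2) atTop

/-- `u` is almost periodic in the sense of Besicovitch: `u ∈ L²_loc(ℝ^N)` and `u` can be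
approximated by trigonometric polynomials for the upper quadratic mean. -/
structure IsBesicovitch {N : ℕ} (u : Euc N → ℂ) : Prop where
  locL2 : ∀ K : Set (Euc N), IsCompact K → MemLp u 2 (volume.restrict K)
  approx : ∀ δ : ℝ≥0∞, 0 < δ → ∃ p ∈ trig N, upperMeanSq (fun y => u y - p y) < δ

lemma upperMeanSq_rpow {N : ℕ} (u : Euc N → ℂ) :
    upperMeanSq u ^ (1 / 2 : ℝ) = limsup (fun n : ℕ => eLpNorm u 2
      ((volume (Metric.ball (0 : Euc N) n))⁻¹ • volume.restrict (Metric.ball (0 : Euc N) n)))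
      atTop := by
  have h := OrderIso.limsup_apply (f := atTop)
    (u := fun n : ℕ => (volume (Metric.ball (0 : Euc N) n))⁻¹ *
      ∫⁻ y in Metric.ball (0 : Euc N) n, ‖u y‖ₑ ^ 2)
    (ENNReal.orderIsoRpow (1 / 2) (by norm_num))
  refine h.trans ?_
  congr 1
  funext n
  rw [eLpNorm_eq_lintegral_rpow_enorm_toReal two_ne_zero ENNReal.ofNat_ne_top]
  simp [ENNReal.orderIsoRpow]

lemma IsBesicovitch.aestronglyMeasurable {N : ℕ} {u : Euc N → ℂ}
    (hu : ∀ K : Set (Euc N), IsCompact K → MemLp u 2 (volume.restrict K)) (n : ℕ) :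
    AEStronglyMeasurable u
      ((volume (Metric.ball (0 : Euc N) n))⁻¹ • volume.restrict (Metric.ball (0 : Euc N) n)) :=
  (((hu _ (isCompact_closedBall (0 : Euc N) n)).aestronglyMeasurable).mono_measure
    (Measure.restrict_mono Metric.ball_subset_closedBall le_rfl)).smul_measure _

lemma limsup_add_le_ennreal (a b : ℕ → ℝ≥0∞) :
    limsup (fun n => a n + b n) atTop ≤ limsup a atTop + limsup b atTop := by
  refine ENNReal.le_of_forall_pos_le_add fun δ hδ hfin => ?_
  have hA : limsup a atTop < ∞ := lt_of_le_of_lt le_self_add hfin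
  have hB : limsup b atTop < ∞ := lt_of_le_of_lt le_add_self hfin
  have hδ' : (0 : ℝ≥0∞) < (δ : ℝ≥0∞) / 2 := ENNReal.half_pos (by exact_mod_cast hδ.ne')
  have ha := eventually_lt_of_limsup_lt (ENNReal.lt_add_right hA.ne hδ'.ne')
  have hb := eventually_lt_of_limsup_lt (ENNReal.lt_add_right hB.ne hδ'.ne')
  refine limsup_le_of_le (by isBoundedDefault) ?_
  filter_upwards [ha, hb] with n h1 h2
  calc a n + b n ≤ (limsup a atTop + δ / 2) + (limsup b atTop + δ / 2) :=
        add_le_add h1.le h2.le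
    _ = limsup a atTop + limsup b atTop + (δ / 2 + δ / 2) := by ring
    _ = limsup a atTop + limsup b atTop + δ := by rw [ENNReal.add_halves]

lemma upperMeanSq_add_rpow_le {N : ℕ} {u v : Euc N → ℂ}
    (hu : ∀ K : Set (Euc N), IsCompact K → MemLp u 2 (volume.restrict K))
    (hv : ∀ K : Set (Euc N), IsCompact K → MemLp v 2 (volume.restrict K)) :
    upperMeanSq (u + v) ^ (1 / 2 : ℝ) ≤
      upperMeanSq u ^ (1 / 2 : ℝ) + upperMeanSq v ^ (1 / 2 : ℝ) := by
  rw [upperMeanSq_rpow, upperMeanSq_rpow, upperMeanSq_rpow]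
  refine le_trans ?_ (limsup_add_le_ennreal _ _)
  exact limsup_le_limsup (Eventually.of_forall fun n => eLpNorm_add_le
    (IsBesicovitch.aestronglyMeasurable hu n) (IsBesicovitch.aestronglyMeasurable hv n)
    one_le_two)

lemma upperMeanSq_smul_rpow {N : ℕ} (c : ℂ) (u : Euc N → ℂ) :
    upperMeanSq (c • u) ^ (1 / 2 : ℝ) = ‖c‖ₑ * upperMeanSq u ^ (1 / 2 : ℝ) := by
  rw [upperMeanSq_rpow, upperMeanSq_rpow, ← ENNReal.limsup_const_mul_of_ne_top enorm_ne_top]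
  congr 1
  funext n
  exact eLpNorm_const_smul c u 2 _

lemma trig_locL2 {N : ℕ} (p : Euc N →ᵇ ℂ) (K : Set (Euc N)) (hK : IsCompact K) :
    MemLp (fun y => p y) 2 (volume.restrict K) := by
  have : IsFiniteMeasure (volume.restrict K) := ⟨by simpa using hK.measure_lt_top⟩
  exact MemLp.of_bound p.continuous.aestronglyMeasurable ‖p‖
    (Eventually.of_forall fun y => p.norm_coe_le_norm y)

lemma upperMeanSq_bdd_lt_top {N : ℕ} (p : Euc N →ᵇ ℂ) : upperMeanSq (fun y => p y) < ∞ := by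
  have h : upperMeanSq (fun y => p y) ≤ ‖p‖ₑ ^ 2 := by
    refine limsup_le_of_le (by isBoundedDefault) (Eventually.of_forall fun n => ?_)
    calc (volume (Metric.ball (0 : Euc N) n))⁻¹ *
          ∫⁻ y in Metric.ball (0 : Euc N) n, ‖p y‖ₑ ^ 2
        ≤ (volume (Metric.ball (0 : Euc N) n))⁻¹ *
          ∫⁻ _ in Metric.ball (0 : Euc N) n, ‖p‖ₑ ^ 2 := by
          gcongr with y
          exact enorm_le_iff_norm_le.2 (p.norm_coe_le_norm y)
      _ = ‖p‖ₑ ^ 2 * ((volume (Metric.ball (0 : Euc N) n))⁻¹ *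
            volume (Metric.ball (0 : Euc N) n)) := by
          rw [setLIntegral_const]; ring
      _ ≤ ‖p‖ₑ ^ 2 * 1 := by gcongr; exact ENNReal.inv_mul_le_one _
      _ = ‖p‖ₑ ^ 2 := mul_one _
  exact lt_of_le_of_lt h (ENNReal.pow_lt_top enorm_lt_top)

lemma IsBesicovitch.approx_rpow {N : ℕ} {u : Euc N → ℂ} (hu : IsBesicovitch u) (η : ℝ≥0∞)
    (hη : 0 < η) : ∃ p ∈ trig N, upperMeanSq (u - fun y => p y) ^ (1 / 2 : ℝ) < η := by
  obtain ⟨p, hp, h⟩ := hu.approx (η ^ (2 : ℝ)) (ENNReal.rpow_pos_of_nonneg hη (by norm_num))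
  refine ⟨p, hp, ?_⟩
  have h' := ENNReal.rpow_lt_rpow h (z := 1 / 2) (by norm_num)
  rw [← ENNReal.rpow_mul] at h'
  norm_num at h' ⊢
  exact h'

lemma IsBesicovitch.of_rpow {N : ℕ} {u : Euc N → ℂ}
    (h : ∀ K : Set (Euc N), IsCompact K → MemLp u 2 (volume.restrict K))
    (h' : ∀ η : ℝ≥0∞, 0 < η →
      ∃ p ∈ trig N, upperMeanSq (u - fun y => p y) ^ (1 / 2 : ℝ) < η) : IsBesicovitch u := by
  refine ⟨h, fun δ hδ => ?_⟩
  obtain ⟨p, hp, hlt⟩ := h' (δ ^ (1 / 2 : ℝ)) (ENNReal.rpow_pos_of_nonneg hδ (by norm_num))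
  exact ⟨p, hp, (ENNReal.rpow_lt_rpow_iff (by norm_num)).1 hlt⟩

lemma IsBesicovitch.add {N : ℕ} {u v : Euc N → ℂ} (hu : IsBesicovitch u)
    (hv : IsBesicovitch v) : IsBesicovitch (u + v) := by
  refine .of_rpow (fun K hK => (hu.locL2 K hK).add (hv.locL2 K hK)) fun η hη => ?_
  obtain ⟨p, hp, h1⟩ := hu.approx_rpow (η / 2) (ENNReal.half_pos hη.ne')
  obtain ⟨q, hq, h2⟩ := hv.approx_rpow (η / 2) (ENNReal.half_pos hη.ne')
  refine ⟨p + q, add_mem hp hq, ?_⟩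
  have e : ((u + v) - fun y => (p + q) y) = (u - fun y => p y) + (v - fun y => q y) := by
    funext y; simp; ring
  rw [e]
  refine lt_of_le_of_lt (upperMeanSq_add_rpow_le
    (fun K hK => (hu.locL2 K hK).sub (trig_locL2 p K hK))
    (fun K hK => (hv.locL2 K hK).sub (trig_locL2 q K hK))) ?_
  calc _ < η / 2 + η / 2 := ENNReal.add_lt_add h1 h2
    _ = η := ENNReal.add_halves η

lemma isBesicovitch_bdd {N : ℕ} {p : Euc N →ᵇ ℂ} (hp : p ∈ trig N) :
    IsBesicovitch (fun y => p y) :=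
  ⟨fun K hK => trig_locL2 p K hK, fun δ hδ => ⟨p, hp, by simpa [upperMeanSq] using hδ⟩⟩

lemma IsBesicovitch.smul {N : ℕ} {u : Euc N → ℂ} (c : ℂ) (hu : IsBesicovitch u) :
    IsBesicovitch (c • u) := by
  refine .of_rpow (fun K hK => (hu.locL2 K hK).const_smul c) fun η hη => ?_
  have hc : ‖c‖ₑ + 1 ≠ ∞ := by simp
  obtain ⟨p, hp, h1⟩ := hu.approx_rpow (η / (‖c‖ₑ + 1)) (ENNReal.div_pos hη.ne' hc)
  refine ⟨c • p, Submodule.smul_mem _ c hp, ?_⟩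
  have e : (c • u - fun y => (c • p) y) = c • (u - fun y => p y) := by
    funext y; simp; ring
  rw [e, upperMeanSq_smul_rpow]
  refine lt_of_le_of_lt (mul_le_mul_left le_self_add _ : _ ≤ (‖c‖ₑ + 1) * _) ?_
  rw [mul_comm]
  exact (ENNReal.lt_div_iff_mul_lt (by simp) (by simp)).1 h1

lemma IsBesicovitch.upperMeanSq_lt_top {N : ℕ} {u : Euc N → ℂ} (hu : IsBesicovitch u) :
    upperMeanSq u ^ (1 / 2 : ℝ) < ∞ := by
  obtain ⟨p, hp, h⟩ := hu.approx_rpow ∞ (by simp)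
  have e : u = (u - fun y => p y) + fun y => p y := by simp
  rw [e]
  exact lt_of_le_of_lt (upperMeanSq_add_rpow_le
    (fun K hK => (hu.locL2 K hK).sub (trig_locL2 p K hK)) (fun K hK => trig_locL2 p K hK))
    (ENNReal.add_lt_top.2
      ⟨h, ENNReal.rpow_lt_top_of_nonneg (by norm_num) (upperMeanSq_bdd_lt_top p).ne⟩)

/-- The Besicovitch functions as a subspace of all functions `ℝ^N → ℂ`. -/
def besicovitchSubmodule (N : ℕ) : Submodule ℂ (Euc N → ℂ) where
  carrier := {u | IsBesicovitch u}
  add_mem' := IsBesicovitch.add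
  zero_mem' := isBesicovitch_bdd (zero_mem (trig N))
  smul_mem' c _ hu := hu.smul c

/-- The space `𝓑²(ℝ^N)`. Its elements are represented by functions, and it carries the seminorm
`(limsup_n |B(0,n)|⁻¹ ∫_{B(0,n)} |u|²)^{1/2} = M(|u|²)^{1/2}`. Two functions at distance zero for
this seminorm represent the same almost periodic function. -/
def Besicovitch (N : ℕ) : Type := besicovitchSubmodule N

namespace Besicovitch

variable {N : ℕ}

instance : AddCommGroup (Besicovitch N) := inferInstanceAs (AddCommGroup (besicovitchSubmodule N))

instance : Module ℂ (Besicovitch N) := inferInstanceAs (Module ℂ (besicovitchSubmodule N))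

instance : CoeFun (Besicovitch N) fun _ => Euc N → ℂ := ⟨fun u => u.1⟩

instance : Norm (Besicovitch N) := ⟨fun u => (upperMeanSq u ^ (1 / 2 : ℝ)).toReal⟩

lemma core (N : ℕ) : SeminormedSpace.Core ℂ (Besicovitch N) where
  norm_nonneg _ := ENNReal.toReal_nonneg
  norm_smul c u := by
    change (upperMeanSq (c • u.1) ^ (1 / 2 : ℝ)).toReal
      = ‖c‖ * (upperMeanSq u.1 ^ (1 / 2 : ℝ)).toReal
    rw [upperMeanSq_smul_rpow, ENNReal.toReal_mul, toReal_enorm]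
  norm_triangle u v := by
    change (upperMeanSq (u.1 + v.1) ^ (1 / 2 : ℝ)).toReal
      ≤ (upperMeanSq u.1 ^ (1 / 2 : ℝ)).toReal + (upperMeanSq v.1 ^ (1 / 2 : ℝ)).toReal
    have hu : IsBesicovitch u.1 := u.2
    have hv : IsBesicovitch v.1 := v.2
    rw [← ENNReal.toReal_add hu.upperMeanSq_lt_top.ne hv.upperMeanSq_lt_top.ne]
    exact ENNReal.toReal_mono
      (ENNReal.add_lt_top.2 ⟨hu.upperMeanSq_lt_top, hv.upperMeanSq_lt_top⟩).ne
      (upperMeanSq_add_rpow_le hu.locL2 hv.locL2)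

instance : SeminormedAddCommGroup (Besicovitch N) := SeminormedAddCommGroup.ofCore (core N)

end Besicovitch

/-! ### Mean values, Fourier coefficients and the divergence in the fast variable -/

/-- `u ∈ L¹_loc(ℝ^N)` has the mean value `m`: for every bounded measurable `ω` of positive
measure, the averages of `u` over `nω` tend to `m`. -/
structure HasMeanValue {N : ℕ} (u : Euc N → ℂ) (m : ℂ) : Prop where
  locInt : LocallyIntegrable u
  tendsto : ∀ ω : Set (Euc N), Bornology.IsBounded ω → MeasurableSet ω → volume ω ≠ 0 →
    Tendsto (fun n : ℕ => ⨍ y in (n : ℝ) • ω, u y) atTop (𝓝 m)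

open Classical in
/-- The mean value `M(u)`; by convention `0` for a function without mean value. -/
def meanValue {N : ℕ} (u : Euc N → ℂ) : ℂ :=
  if h : ∃ m, HasMeanValue u m then h.choose else 0

/-- The coefficient `a_ξ = M(e^{-i ξ·y} u)` of the formal series `u = ∑_ξ a_ξ e^{i ξ·y}`. -/
def fourierCoeff {N : ℕ} (u : Euc N → ℂ) (ξ : Euc N) : ℂ :=
  meanValue fun y => Complex.exp (-(Complex.I * (inner ℝ ξ y : ℝ))) * u y

/-- The divergence with respect to the three coordinates `σ 0, σ 1, σ 2` of `ℝ^N` of a vector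
field with components in `𝓑²(ℝ^N)`, as a formal series, i.e. through its family of coefficients:
`∂_k (∑_ξ a_ξ e^{i ξ·y}) = i ∑_ξ ξ_k a_ξ e^{i ξ·y}`. -/
def formalDiv {N : ℕ} (σ : Fin 3 → Fin N) (u : Fin 3 → Euc N → ℂ) : Euc N → ℂ :=
  fun ξ => ∑ j, Complex.I * (ξ (σ j) : ℂ) * fourierCoeff (u j) ξ

/-! ### Two-scale convergence, weak divergence, and the data -/

/-- `u_n` (a sequence in `L²(Ω)`, attached to the sequence of scales `ε_n`) two-scale converges to
`û ∈ L²(Ω; 𝓑²(ℝ^N))`. The test functions are those of `C⁰_c(Ω; CAP(ℝ^N))`. -/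
structure TwoScaleTendsto {N : ℕ} (Ω : Set (Euc N)) (ε : ℕ → ℝ) (u : ℕ → Euc N → ℂ)
    (uhat : Euc N → Besicovitch N) : Prop where
  memLp : ∀ n, MemLp (u n) 2 (volume.restrict Ω)
  memLp_limit : MemLp uhat 2 (volume.restrict Ω)
  tendsto : ∀ ψ : Euc N → (Euc N →ᵇ ℂ), Continuous ψ → HasCompactSupport ψ → tsupport ψ ⊆ Ω →
    (∀ x, ψ x ∈ bohrAP N) →
    Tendsto (fun n => ∫ x in Ω, u n x * ψ x ((ε n)⁻¹ • x)) atTop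
      (𝓝 (∫ x in Ω, meanValue fun y => uhat x y * ψ x y))

/-- The sequence `u_n` is bounded in `L²(Ω)`. -/
def BoundedL2 {N : ℕ} {F : Type*} [NormedAddCommGroup F] (Ω : Set (Euc N))
    (u : ℕ → Euc N → F) : Prop :=
  (∀ n, MemLp (u n) 2 (volume.restrict Ω)) ∧
    ∃ C : ℝ≥0, ∀ n, eLpNorm (u n) 2 (volume.restrict Ω) ≤ C

/-- `d` is the divergence of `u` in the sense of distributions in `Ω`, with respect to the three
coordinates `σ 0, σ 1, σ 2` of `ℝ^N`. -/
def IsWeakDiv {N : ℕ} (σ : Fin 3 → Fin N) (Ω : Set (Euc N)) (u : Euc N → Fin 3 → ℂ)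
    (d : Euc N → ℂ) : Prop :=
  ∀ φ : Euc N → ℂ, ContDiff ℝ (⊤ : ℕ∞) φ → HasCompactSupport φ → tsupport φ ⊆ Ω →
    ∫ x in Ω, ∑ j, u x j * fderiv ℝ φ x (EuclideanSpace.single (σ j) 1) =
      -∫ x in Ω, d x * φ x

/-- The distributional divergences of `u_n` are functions that form a bounded sequence in
`L²(Ω)`. -/
def BoundedDiv {N : ℕ} (σ : Fin 3 → Fin N) (Ω : Set (Euc N)) (u : ℕ → Euc N → Fin 3 → ℂ) :
    Prop :=
  ∃ d : ℕ → Euc N → ℂ, BoundedL2 Ω d ∧ ∀ n, IsWeakDiv σ Ω (u n) (d n)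

/-- The space-time cylinder `(0,T) × ℝ³` in `ℝ⁴`; the coordinate `0` is the time, the coordinates
`1, 2, 3` are those of space. -/
def timeSpace (T : ℝ) : Set (Euc 4) := {z | 0 < z 0 ∧ z 0 < T}

/-- The coefficient matrix: bounded measurable, periodic with period the unit cube, hermitian and
uniformly elliptic. -/
structure IsCoefficient (P : Euc 3 → Matrix (Fin 3) (Fin 3) ℂ) : Prop where
  bounded : ∀ i j, MemLp (fun y => P y i j) ∞ volume
  periodic : ∀ (k : Fin 3) (y : Euc 3), P (y + EuclideanSpace.single k 1) = P y
  hermitian : ∀ᵐ y, (P y).IsHermitian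
  elliptic : ∃ α : ℝ, 0 < α ∧ ∀ᵐ y, ∀ η : Fin 3 → ℂ,
    α * ∑ i, ‖η i‖ ^ 2 ≤ (star η ⬝ᵥ (P y).mulVec η).re

end TwoScaleMaxwell

end

open TwoScaleMaxwell

namespace TwoScaleMaxwell

/-! Suppose `u_n` is bounded in `L²` with divergences `d_n` bounded in `L²`. Test the weak
divergence with `φ(x) e_ζ(x/ε_n)` and multiply by `ε_n`. The term with `d_n` and the terms in which
the derivative falls on `φ` are `O(ε_n)`; what survives is `∑ iζ_j ∫ u_{n,j} φ e_ζ(x/ε_n)`. Its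
two-scale limit gives `∑ iζ_j ∫ φ M(e_ζ v_j) = 0` (`sum_integral_eq_zero`). For `ζ = -ξ` the mean
values are the Fourier coefficients at `ξ`, so the coefficient of the divergence at `ξ` vanishes for
a.e. `x`.

The exceptional null set depends on `ξ`, which ranges over an uncountable set. Each Besicovitch
function has a countable spectrum, and a strongly measurable limit has essentially separable range;
hence one countable set of frequencies serves for a.e. `x` (`exists_countable_spectrum`,
`ae_formalDiv_eq_zero`), and `ae_formalDiv_limit_eq_zero` follows.

For the electric field the same result is applied to `P(x/ε_n) E⁰_n`, once its two-scale limit is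
known to be `P Ê⁰`. As `P` is merely bounded and measurable, `P(y)` times a test function need not
be admissible. Instead, Fourier series on the torus make each periodic entry a quadratic-mean limit
of trigonometric polynomials (`isMultiplier_of_periodic`). The error of this approximation, rescaled
to a fixed ball, is small in `L²` uniformly for small `ε_n`
(`exists_eventually_eLpNorm_comp_smul_le`), so convergence passes to the product
(`TrigTendsto.mul_multiplier`).

All of this needs mean values to exist. They exist for characters by the Riemann–Lebesgue lemma, and
for Besicovitch functions by density (`IsBesicovitch.exists_hasMeanValue`). -/

/-! ### Averages and the quadratic seminorm -/

/-- The normalized restriction of Lebesgue measure to `s`. -/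
noncomputable def avgOn {N : ℕ} (s : Set (Euc N)) : Measure (Euc N) :=
  (volume s)⁻¹ • volume.restrict s

/-- Local square integrability. -/
def LocL2 {N : ℕ} (u : Euc N → ℂ) : Prop :=
  ∀ K : Set (Euc N), IsCompact K → MemLp u 2 (volume.restrict K)

/-- The Besicovitch seminorm with values in `[0, ∞]`. -/
noncomputable def besNorm {N : ℕ} (u : Euc N → ℂ) : ℝ≥0∞ := upperMeanSq u ^ (1 / 2 : ℝ)

variable {N : ℕ}

lemma LocL2.add {u v : Euc N → ℂ} (hu : LocL2 u) (hv : LocL2 v) : LocL2 (u + v) :=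
  fun K hK => (hu K hK).add (hv K hK)

lemma LocL2.sub {u v : Euc N → ℂ} (hu : LocL2 u) (hv : LocL2 v) : LocL2 (u - v) :=
  fun K hK => (hu K hK).sub (hv K hK)

lemma locL2_bdd (p : Euc N →ᵇ ℂ) : LocL2 fun y => p y := trig_locL2 p

lemma LocL2.memLp_of_isBounded {u : Euc N → ℂ} (hu : LocL2 u) {s : Set (Euc N)}
    (hs : Bornology.IsBounded s) : MemLp u 2 (volume.restrict s) :=
  (hu _ hs.isCompact_closure).mono_measure (Measure.restrict_mono subset_closure le_rfl)

lemma LocL2.memLp_avgOn {u : Euc N → ℂ} (hu : LocL2 u) {s : Set (Euc N)}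
    (hs : Bornology.IsBounded s) (h0 : volume s ≠ 0) : MemLp u 2 (avgOn s) :=
  (hu.memLp_of_isBounded hs).smul_measure (ENNReal.inv_ne_top.2 h0)

lemma LocL2.aestronglyMeasurable {u : Euc N → ℂ} (hu : LocL2 u) : AEStronglyMeasurable u := by
  have h := aestronglyMeasurable_iUnion_iff (μ := (volume : Measure (Euc N))) (f := u)
    (s := fun n : ℕ => Metric.closedBall (0 : Euc N) n)
  rw [Metric.iUnion_closedBall_nat, Measure.restrict_univ] at h
  exact h.2 fun n => (hu _ (isCompact_closedBall _ _)).aestronglyMeasurable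

lemma LocL2.locallyIntegrable {u : Euc N → ℂ} (hu : LocL2 u) : LocallyIntegrable u := by
  rw [locallyIntegrable_iff]
  intro K hK
  have : IsFiniteMeasure (volume.restrict K) := ⟨by simpa using hK.measure_lt_top⟩
  exact (hu K hK).integrable one_le_two

lemma setAverage_eq_integral_avgOn (s : Set (Euc N)) (u : Euc N → ℂ) :
    ⨍ y in s, u y = ∫ y, u y ∂(avgOn s) := by
  rw [average, Measure.restrict_apply_univ, avgOn]

/-- Cauchy–Schwarz for the normalized measure. -/
lemma enorm_setAverage_mul_le {u v : Euc N → ℂ} (hu : LocL2 u) (hv : LocL2 v) {s : Set (Euc N)}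
    (hs : Bornology.IsBounded s) (h0 : volume s ≠ 0) :
    ‖⨍ y in s, u y * v y‖ₑ ≤ eLpNorm u 2 (avgOn s) * eLpNorm v 2 (avgOn s) := by
  rw [setAverage_eq_integral_avgOn]
  refine (enorm_integral_le_lintegral_enorm _).trans ?_
  rw [← eLpNorm_one_eq_lintegral_enorm]
  have h := eLpNorm_smul_le_mul_eLpNorm (p := 2) (q := 2) (r := 1)
    (hv.memLp_avgOn hs h0).aestronglyMeasurable (hu.memLp_avgOn hs h0).aestronglyMeasurable
  exact h

lemma eLpNorm_one_avgOn_le (s : Set (Euc N)) :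
    eLpNorm (fun _ : Euc N => (1 : ℂ)) 2 (avgOn s) ≤ 1 := by
  by_cases h : avgOn s = 0
  · simp [h]
  rw [eLpNorm_const _ two_ne_zero h]
  simp only [enorm_one, one_mul]
  refine ENNReal.rpow_le_one ?_ (by simp)
  simp only [avgOn, Measure.smul_apply, Measure.restrict_apply_univ, smul_eq_mul]
  exact ENNReal.inv_mul_le_one _

lemma enorm_setAverage_le {u : Euc N → ℂ} (hu : LocL2 u) {s : Set (Euc N)}
    (hs : Bornology.IsBounded s) (h0 : volume s ≠ 0) :
    ‖⨍ y in s, u y‖ₑ ≤ eLpNorm u 2 (avgOn s) := by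
  have h := enorm_setAverage_mul_le hu (locL2_bdd 1) hs h0
  simp only [BoundedContinuousFunction.coe_one, Pi.one_apply, mul_one] at h
  exact h.trans (mul_le_of_le_one_right' (eLpNorm_one_avgOn_le s))

lemma eventually_eLpNorm_lt {u : Euc N → ℂ} {η : ℝ≥0∞} (h : besNorm u < η) :
    ∀ᶠ n : ℕ in atTop, eLpNorm u 2 (avgOn (Metric.ball (0 : Euc N) n)) < η := by
  rw [besNorm, upperMeanSq_rpow] at h
  exact eventually_lt_of_limsup_lt h

lemma smul_ball_zero {n : ℕ} (hn : n ≠ 0) (r : ℝ) :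
    (n : ℝ) • Metric.ball (0 : Euc N) r = Metric.ball (0 : Euc N) (n * r) := by
  rw [smul_ball (by exact_mod_cast hn)]
  simp

/-- The seminorm sees only balls of integer radius, whereas mean values use all dilates `nω`.
Enclosing `ω` in a ball of integer radius `R` puts `nω` inside the ball of radius `nR`; both volumes
scale by the same factor, so the loss `(|B_R| / |ω|)^{1/2}` does not depend on `n`. -/
lemma exists_eLpNorm_avgOn_smul_le {ω : Set (Euc N)} (hb : Bornology.IsBounded ω)
    (h0 : volume ω ≠ 0) : ∃ R : ℕ, R ≠ 0 ∧ ∃ C : ℝ≥0∞, C ≠ ∞ ∧ ∀ (u : Euc N → ℂ) (n : ℕ), n ≠ 0 →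
      eLpNorm u 2 (avgOn ((n : ℝ) • ω)) ≤
        C * eLpNorm u 2 (avgOn (Metric.ball (0 : Euc N) ((n * R : ℕ) : ℝ))) := by
  obtain ⟨r, hr⟩ := hb.subset_ball (0 : Euc N)
  obtain ⟨R, hR⟩ := exists_nat_gt (max r 0)
  have hRpos : (0 : ℝ) < R := lt_of_le_of_lt (le_max_right _ _) hR
  have hsub : ω ⊆ Metric.ball (0 : Euc N) R :=
    hr.trans (Metric.ball_subset_ball ((le_max_left _ _).trans hR.le))
  have hB0 : volume (Metric.ball (0 : Euc N) R) ≠ 0 :=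
    (Metric.measure_ball_pos volume _ hRpos).ne'
  have hB1 : volume (Metric.ball (0 : Euc N) R) ≠ ∞ := measure_ball_lt_top.ne
  have hω1 : volume ω ≠ ∞ := hb.measure_lt_top.ne
  refine ⟨R, by exact_mod_cast hRpos.ne',
    (volume (Metric.ball (0 : Euc N) R) * (volume ω)⁻¹) ^ (1 / 2 : ℝ),
    ENNReal.rpow_ne_top_of_nonneg (by norm_num) (ENNReal.mul_ne_top hB1 (by simpa using h0)),
    fun u n hn => ?_⟩
  have hc0 : ENNReal.ofReal |(n : ℝ) ^ Module.finrank ℝ (Euc N)| ≠ 0 := by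
    simp [hn]
  rw [avgOn, avgOn, eLpNorm_smul_measure_of_ne_top (by simp), eLpNorm_smul_measure_of_ne_top (by simp)]
  push_cast
  rw [← smul_ball_zero hn]
  simp only [smul_eq_mul, Measure.addHaar_smul]
  set c := ENNReal.ofReal |(n : ℝ) ^ Module.finrank ℝ (Euc N)| with hc
  have hc1 : c ≠ ∞ := ENNReal.ofReal_ne_top
  have e : (c * volume ω)⁻¹ = (volume (Metric.ball (0 : Euc N) R) * (volume ω)⁻¹) *
      (c * volume (Metric.ball (0 : Euc N) R))⁻¹ := by
    rw [ENNReal.mul_inv (Or.inl hc0) (Or.inl hc1), ENNReal.mul_inv (Or.inl hc0) (Or.inl hc1)]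
    calc c⁻¹ * (volume ω)⁻¹ = (volume (Metric.ball (0 : Euc N) R) *
          (volume (Metric.ball (0 : Euc N) R))⁻¹) * (c⁻¹ * (volume ω)⁻¹) := by
          rw [ENNReal.mul_inv_cancel hB0 hB1, one_mul]
      _ = _ := by ring
  have e2 : (1 / 2 : ℝ≥0∞).toReal = (1 / 2 : ℝ) := by simp
  rw [e, e2, ENNReal.mul_rpow_of_nonneg _ _ (by norm_num), mul_assoc]
  gcongr

lemma exists_eventually_average_le {ω : Set (Euc N)} (hb : Bornology.IsBounded ω)
    (h0 : volume ω ≠ 0) : ∃ C : ℝ≥0∞, C ≠ ∞ ∧ ∀ (u : Euc N → ℂ), LocL2 u → ∀ η : ℝ≥0∞,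
      besNorm u < η → ∀ᶠ n : ℕ in atTop, ‖⨍ y in (n : ℝ) • ω, u y‖ₑ ≤ C * η := by
  obtain ⟨R, hR, C, hC, h⟩ := exists_eLpNorm_avgOn_smul_le hb h0
  refine ⟨C, hC, fun u hu η hη => ?_⟩
  have ht : Tendsto (fun n : ℕ => n * R) atTop atTop :=
    tendsto_id.atTop_mul_const' (Nat.pos_of_ne_zero hR)
  filter_upwards [ht.eventually (eventually_eLpNorm_lt hη), eventually_ne_atTop 0] with n h1 h2
  refine (enorm_setAverage_le hu (hb.smul₀ _) ?_).trans ((h u n h2).trans ?_)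
  · rw [Measure.addHaar_smul]
    simp [h2, h0]
  · gcongr

lemma besNorm_add_le {u v : Euc N → ℂ} (hu : LocL2 u) (hv : LocL2 v) :
    besNorm (u + v) ≤ besNorm u + besNorm v := upperMeanSq_add_rpow_le hu hv

lemma besNorm_smul (c : ℂ) (u : Euc N → ℂ) : besNorm (c • u) = ‖c‖ₑ * besNorm u :=
  upperMeanSq_smul_rpow c u

lemma besNorm_neg (u : Euc N → ℂ) : besNorm (-u) = besNorm u := by
  simpa using besNorm_smul (-1) u

lemma besNorm_sub_comm (u v : Euc N → ℂ) : besNorm (u - v) = besNorm (v - u) := by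
  rw [← besNorm_neg, neg_sub]

lemma besNorm_sub_le {u v w : Euc N → ℂ} (hu : LocL2 u) (hv : LocL2 v) (hw : LocL2 w) :
    besNorm (u - w) ≤ besNorm (u - v) + besNorm (v - w) := by
  simpa using besNorm_add_le (hu.sub hv) (hv.sub hw)

/-! ### Existence of mean values -/

lemma hasMeanValue_unique {u : Euc N → ℂ} {m m' : ℂ} (h : HasMeanValue u m)
    (h' : HasMeanValue u m') : m = m' := by
  have hb : volume (Metric.ball (0 : Euc N) 1) ≠ 0 :=
    (Metric.measure_ball_pos volume _ one_pos).ne'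
  exact tendsto_nhds_unique (h.tendsto _ Metric.isBounded_ball measurableSet_ball hb)
    (h'.tendsto _ Metric.isBounded_ball measurableSet_ball hb)

lemma HasMeanValue.meanValue_eq {u : Euc N → ℂ} {m : ℂ} (h : HasMeanValue u m) :
    meanValue u = m := by
  have h' : ∃ m, HasMeanValue u m := ⟨m, h⟩
  rw [meanValue, dif_pos h']
  exact hasMeanValue_unique h'.choose_spec h

lemma HasMeanValue.add {u v : Euc N → ℂ} {m m' : ℂ} (h : HasMeanValue u m)
    (h' : HasMeanValue v m') : HasMeanValue (u + v) (m + m') := by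
  refine ⟨h.locInt.add h'.locInt, fun ω hb hm h0 => ?_⟩
  refine ((h.tendsto ω hb hm h0).add (h'.tendsto ω hb hm h0)).congr fun n => ?_
  have hn : Bornology.IsBounded ((n : ℝ) • ω) := hb.smul₀ _
  have hint : ∀ w : Euc N → ℂ, LocallyIntegrable w → IntegrableOn w ((n : ℝ) • ω) := fun w hw =>
    ((locallyIntegrable_iff.1 hw) _ hn.isCompact_closure).mono_set subset_closure
  simp only [setAverage_eq, Pi.add_apply]
  rw [integral_add (hint u h.locInt) (hint v h'.locInt), smul_add]

lemma HasMeanValue.const_mul {u : Euc N → ℂ} {m : ℂ} (c : ℂ) (h : HasMeanValue u m) :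
    HasMeanValue (fun y => c * u y) (c * m) := by
  refine ⟨h.locInt.smul c, fun ω hb hm h0 => ?_⟩
  refine ((h.tendsto ω hb hm h0).const_mul c).congr fun n => ?_
  simp only [setAverage_eq]
  rw [integral_const_mul, mul_smul_comm]

/-- Cauchy–Schwarz on the balls `B(0,n)` passes to the limit. The margin `δ` is there because a
limsup controls the averages only eventually and up to a positive error. -/
lemma HasMeanValue.enorm_le {u v : Euc N → ℂ} {m : ℂ} (h : HasMeanValue (fun y => u y * v y) m)
    (hu : LocL2 u) (hv : LocL2 v) (hu' : besNorm u ≠ ∞) (hv' : besNorm v ≠ ∞) :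
    ‖m‖ₑ ≤ besNorm u * besNorm v := by
  have hb : volume (Metric.ball (0 : Euc N) 1) ≠ 0 :=
    (Metric.measure_ball_pos volume _ one_pos).ne'
  have key : ∀ δ : ℝ≥0, 0 < δ → ‖m‖ₑ ≤ (besNorm u + δ) * (besNorm v + δ) := by
    intro δ hδ
    have hδ' : (δ : ℝ≥0∞) ≠ 0 := by exact_mod_cast hδ.ne'
    refine le_of_tendsto (h.tendsto _ Metric.isBounded_ball measurableSet_ball hb).enorm ?_
    filter_upwards [eventually_eLpNorm_lt (ENNReal.lt_add_right hu' hδ'),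
      eventually_eLpNorm_lt (ENNReal.lt_add_right hv' hδ'), eventually_ne_atTop 0] with n h1 h2 h3
    rw [smul_ball_zero h3, mul_one]
    refine (enorm_setAverage_mul_le hu hv Metric.isBounded_ball ?_).trans
      (mul_le_mul' h1.le h2.le)
    exact (Metric.measure_ball_pos volume _ (by exact_mod_cast Nat.pos_of_ne_zero h3)).ne'
  have hlim : Tendsto (fun δ : ℝ≥0 => (besNorm u + δ) * (besNorm v + δ)) (𝓝[>] 0)
      (𝓝 ((besNorm u + (0 : ℝ≥0)) * (besNorm v + (0 : ℝ≥0)))) := by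
    have hc : Tendsto (fun δ : ℝ≥0 => (δ : ℝ≥0∞)) (𝓝[>] 0) (𝓝 ((0 : ℝ≥0) : ℝ≥0∞)) :=
      (ENNReal.continuous_coe.tendsto 0).mono_left nhdsWithin_le_nhds
    exact ENNReal.Tendsto.mul (tendsto_const_nhds.add hc) (Or.inr (by simpa using hv'))
      (tendsto_const_nhds.add hc) (Or.inr (by simpa using hu'))
  have := ge_of_tendsto hlim (eventually_mem_nhdsWithin.mono fun δ hδ => key δ hδ)
  simpa using this

lemma besNorm_one_le : besNorm (fun _ : Euc N => (1 : ℂ)) ≤ 1 := by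
  rw [besNorm, upperMeanSq_rpow]
  exact limsup_le_of_le (by isBoundedDefault)
    (Eventually.of_forall fun n => eLpNorm_one_avgOn_le _)

lemma HasMeanValue.enorm_le_besNorm {u : Euc N → ℂ} {m : ℂ} (h : HasMeanValue u m)
    (hu : LocL2 u) (hu' : besNorm u ≠ ∞) : ‖m‖ₑ ≤ besNorm u := by
  have h1 : LocL2 fun _ : Euc N => (1 : ℂ) := locL2_bdd 1
  have h' : HasMeanValue (fun y => u y * (fun _ => (1 : ℂ)) y) m := by simpa using h
  exact (h'.enorm_le hu h1 hu' (besNorm_one_le.trans_lt ENNReal.one_lt_top).ne).trans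
    (mul_le_of_le_one_right' besNorm_one_le)

-- Rescaling turns the average of `e_ξ` over `nω` into the Fourier transform of the indicator of `ω`
-- at a frequency proportional to `nξ`, which tends to zero by the Riemann–Lebesgue lemma when `ξ ≠
-- 0`.
open scoped FourierTransform in
lemma hasMeanValue_char (ξ : Euc N) :
    HasMeanValue (fun y => BoundedContinuousFunction.innerProbChar ξ y)
      (if ξ = 0 then 1 else 0) := by
  refine ⟨(locL2_bdd _).locallyIntegrable, fun ω hb hm h0 => ?_⟩
  have hω1 : volume ω ≠ ∞ := hb.measure_lt_top.ne
  split_ifs with hξ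
  · subst hξ
    refine tendsto_const_nhds.congr' ?_
    filter_upwards [eventually_ne_atTop 0] with n hn
    simp only [BoundedContinuousFunction.innerProbChar_zero, BoundedContinuousFunction.coe_one,
      Pi.one_apply]
    rw [setAverage_const]
    · rw [Measure.addHaar_smul]; simp [hn, h0]
    · rw [Measure.addHaar_smul]; exact ENNReal.mul_ne_top ENNReal.ofReal_ne_top hω1
  · have hRL := tendsto_integral_exp_inner_smul_cocompact (V := Euc N) (E := ℂ)
      (ω.indicator fun _ => 1)
    -- The factor `-1/(2π)` translates `e^{iξ·y}` into the kernel `e^{-2πi⟨·,·⟩}` of the Fourier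
    -- transform.
    have ht : Tendsto (fun n : ℕ => (-(n : ℝ) / (2 * Real.pi)) • ξ) atTop (cocompact (Euc N)) := by
      rw [← Metric.cobounded_eq_cocompact, ← tendsto_norm_atTop_iff_cobounded]
      have h1 : Tendsto (fun n : ℕ => (n : ℝ) * (‖ξ‖ / (2 * Real.pi))) atTop atTop :=
        tendsto_natCast_atTop_atTop.atTop_mul_const
          (div_pos (norm_pos_iff.2 hξ) Real.two_pi_pos)
      refine h1.congr fun n => ?_
      rw [norm_smul, norm_div, norm_neg, Real.norm_natCast, Real.norm_of_nonneg Real.two_pi_pos.le]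
      ring
    have := (hRL.comp ht).const_smul ((volume.real ω)⁻¹)
    rw [smul_zero] at this
    refine this.congr' ?_
    filter_upwards [eventually_ne_atTop 0] with n hn
    have hn' : (n : ℝ) ≠ 0 := by exact_mod_cast hn
    have hd : |(n : ℝ) ^ Module.finrank ℝ (Euc N)| ≠ 0 := by positivity
    have hs := Measure.setIntegral_comp_smul volume
      (fun y : Euc N => BoundedContinuousFunction.innerProbChar ξ y) ω hn'
    have hv : volume.real ((n : ℝ) • ω) =
        volume.real ω * |(n : ℝ) ^ Module.finrank ℝ (Euc N)| := by
      rw [measureReal_def, Measure.addHaar_smul, ENNReal.toReal_mul,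
        ENNReal.toReal_ofReal (abs_nonneg _), mul_comm, measureReal_def]
    rw [setAverage_eq, hv, mul_inv, mul_smul, ← abs_inv, ← hs, ← integral_indicator hm]
    simp only [Function.comp_apply]
    congr 2
    funext y
    by_cases hy : y ∈ ω
    · simp only [indicator_of_mem hy, BoundedContinuousFunction.innerProbChar_apply,
        Circle.smul_def, Real.fourierChar_apply, smul_eq_mul, mul_one, inner_smul_left,
        inner_smul_right]
      congr 2
      norm_cast
      simp
      field_simp
    · simp [hy]

lemma char_mem_trig (ξ : Euc N) : BoundedContinuousFunction.innerProbChar ξ ∈ trig N :=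
  Submodule.subset_span ⟨ξ, rfl⟩

lemma char_mul_char (ξ η : Euc N) : BoundedContinuousFunction.innerProbChar ξ *
    BoundedContinuousFunction.innerProbChar η =
      BoundedContinuousFunction.innerProbChar (ξ + η) := by
  ext y
  simp only [BoundedContinuousFunction.mul_apply, BoundedContinuousFunction.innerProbChar_apply,
    inner_add_right, ← Complex.exp_add]
  congr 1
  push_cast
  ring

lemma mul_mem_trig {p q : Euc N →ᵇ ℂ} (hp : p ∈ trig N) (hq : q ∈ trig N) : p * q ∈ trig N := by
  have h := Submodule.mul_mem_mul hp hq
  rw [trig, Submodule.span_mul_span] at h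
  refine Submodule.span_mono ?_ h
  rintro _ ⟨_, ⟨ξ, rfl⟩, _, ⟨η, rfl⟩, rfl⟩
  exact ⟨ξ + η, (char_mul_char ξ η).symm⟩

lemma exists_hasMeanValue_trig {p : Euc N →ᵇ ℂ} (hp : p ∈ trig N) :
    ∃ m, HasMeanValue (fun y => p y) m := by
  induction hp using Submodule.span_induction with
  | mem x hx => obtain ⟨ξ, rfl⟩ := hx; exact ⟨_, hasMeanValue_char ξ⟩
  | zero => exact ⟨_, by simpa using (hasMeanValue_char (0 : Euc N)).const_mul 0⟩
  | add x y _ _ hx hy =>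
    obtain ⟨m, hm⟩ := hx
    obtain ⟨m', hm'⟩ := hy
    exact ⟨m + m', hm.add hm'⟩
  | smul c x _ hx =>
    obtain ⟨m, hm⟩ := hx
    exact ⟨c * m, hm.const_mul c⟩

lemma HasMeanValue.sub {u v : Euc N → ℂ} {m m' : ℂ} (h : HasMeanValue u m)
    (h' : HasMeanValue v m') : HasMeanValue (u - v) (m - m') := by
  have := h.add (h'.const_mul (-1))
  simpa [sub_eq_add_neg, Pi.add_def, Pi.sub_def] using this

lemma IsBesicovitch.besNorm_ne_top {u : Euc N → ℂ} (hu : IsBesicovitch u) : besNorm u ≠ ∞ :=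
  hu.upperMeanSq_lt_top.ne

lemma IsBesicovitch.exists_trig {u : Euc N → ℂ} (hu : IsBesicovitch u) {η : ℝ≥0∞} (hη : η ≠ 0) :
    ∃ p ∈ trig N, besNorm (u - fun y => p y) < η := hu.approx_rpow η (pos_iff_ne_zero.2 hη)

/-- Every almost periodic function in the sense of Besicovitch has a mean value. -/
lemma IsBesicovitch.exists_hasMeanValue {u : Euc N → ℂ} (hu : IsBesicovitch u) :
    ∃ m, HasMeanValue u m := by
  have hloc : LocL2 u := hu.locL2
  have happ : ∀ k : ℕ, ∃ p ∈ trig N, besNorm (u - fun y => p y) < ENNReal.ofReal ((1 / 2) ^ k) :=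
    fun k => hu.exists_trig (by simp)
  choose p hp hup using happ
  choose m hm using fun k => exists_hasMeanValue_trig (hp k)
  -- The mean value is bounded by the seminorm, so the means of the approximants form a Cauchy
  -- sequence; comparing consecutive approximants through `u` costs twice the larger error.
  have hdist : ∀ k, dist (m k) (m (k + 1)) ≤ 2 * (1 / 2) ^ k := by
    intro k
    have h1 : besNorm ((fun y => p k y) - fun y => p (k + 1) y) ≤
        ENNReal.ofReal (2 * (1 / 2) ^ k) := by
      refine (besNorm_sub_le (locL2_bdd _) hloc (locL2_bdd _)).trans ?_
      rw [besNorm_sub_comm, two_mul, ENNReal.ofReal_add (by positivity) (by positivity)]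
      refine add_le_add (hup k).le ((hup (k + 1)).le.trans (ENNReal.ofReal_le_ofReal ?_))
      exact pow_le_pow_of_le_one (by norm_num) (by norm_num) (Nat.le_succ k)
    have h2 := ((hm k).sub (hm (k + 1))).enorm_le_besNorm ((locL2_bdd _).sub (locL2_bdd _))
      (h1.trans_lt ENNReal.ofReal_lt_top).ne
    have h3 := h2.trans h1
    rw [← ofReal_norm, ENNReal.ofReal_le_ofReal_iff (by positivity)] at h3
    rwa [dist_eq_norm]
  obtain ⟨l, hl⟩ := cauchySeq_tendsto_of_complete
    (cauchySeq_of_le_geometric (1 / 2) 2 (by norm_num) hdist)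
  refine ⟨l, hloc.locallyIntegrable, fun ω hb hmeas h0 => ?_⟩
  -- The constant `C` depends on `ω` but the candidate limit `l` does not, so the approximant `p k`
  -- may be chosen after `ω`.
  obtain ⟨C, hC, hCb⟩ := exists_eventually_average_le hb h0
  rw [Metric.tendsto_atTop']
  intro e he
  have hpow : Tendsto (fun k : ℕ => C.toReal * (1 / 2 : ℝ) ^ k) atTop (𝓝 0) := by
    simpa using (tendsto_pow_atTop_nhds_zero_of_lt_one (r := (1 / 2 : ℝ)) (by norm_num)
      (by norm_num)).const_mul C.toReal
  obtain ⟨k, hk1, hk2⟩ := ((hpow.eventually_lt_const (show 0 < e / 3 by positivity)).and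
    (Metric.tendsto_nhds.1 hl (e / 3) (by positivity))).exists
  have hA := hCb _ (hloc.sub (locL2_bdd (p k))) _ (hup k)
  have hB := Metric.tendsto_nhds.1 ((hm k).tendsto ω hb hmeas h0) (e / 3) (by positivity)
  obtain ⟨n0, hn0⟩ := eventually_atTop.1 (hA.and hB)
  refine ⟨n0, fun n hn => ?_⟩
  obtain ⟨h1, h2⟩ := hn0 n hn.le
  have hnb : Bornology.IsBounded ((n : ℝ) • ω) := hb.smul₀ _
  have hint : ∀ w : Euc N → ℂ, LocallyIntegrable w → IntegrableOn w ((n : ℝ) • ω) := fun w hw =>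
    ((locallyIntegrable_iff.1 hw) _ hnb.isCompact_closure).mono_set subset_closure
  have h3 : ‖(⨍ y in (n : ℝ) • ω, u y) - ⨍ y in (n : ℝ) • ω, p k y‖ < e / 3 := by
    refine lt_of_le_of_lt ?_ hk1
    have h4 : ⨍ y in (n : ℝ) • ω, (u - fun y => p k y) y =
        (⨍ y in (n : ℝ) • ω, u y) - ⨍ y in (n : ℝ) • ω, p k y := by
      simp only [setAverage_eq, Pi.sub_apply]
      rw [integral_sub (hint _ hloc.locallyIntegrable)
        (hint _ (locL2_bdd (p k)).locallyIntegrable), smul_sub]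
    rw [h4, ← ENNReal.ofReal_toReal hC, ← ENNReal.ofReal_mul ENNReal.toReal_nonneg,
      ← ofReal_norm, ENNReal.ofReal_le_ofReal_iff (by positivity)] at h1
    exact h1
  calc dist (⨍ y in (n : ℝ) • ω, u y) l
      ≤ dist (⨍ y in (n : ℝ) • ω, u y) (⨍ y in (n : ℝ) • ω, p k y) +
        dist (⨍ y in (n : ℝ) • ω, p k y) (m k) + dist (m k) l := dist_triangle4 _ _ _ _
    _ < e / 3 + e / 3 + e / 3 := by
        rw [dist_eq_norm]
        exact add_lt_add (add_lt_add h3 h2) hk2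
    _ = e := by ring

lemma IsBesicovitch.hasMeanValue {u : Euc N → ℂ} (hu : IsBesicovitch u) :
    HasMeanValue u (meanValue u) := by
  obtain ⟨m, hm⟩ := hu.exists_hasMeanValue
  rwa [hm.meanValue_eq]

/-! ### Multipliers -/

/-- Essentially bounded Besicovitch functions; they act on the Besicovitch space. -/
structure IsMultiplier (m : Euc N → ℂ) : Prop where
  besicovitch : IsBesicovitch m
  bounded : ∃ C : ℝ≥0, ∀ᵐ y, ‖m y‖₊ ≤ C

lemma isMultiplier_trig {p : Euc N →ᵇ ℂ} (hp : p ∈ trig N) : IsMultiplier fun y => p y :=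
  ⟨isBesicovitch_bdd hp, ‖p‖₊, Eventually.of_forall fun y => p.nnnorm_coe_le_nnnorm y⟩

lemma besNorm_mul_le {m u : Euc N → ℂ} {C : ℝ≥0} (hC : ∀ᵐ y, ‖m y‖₊ ≤ C) :
    besNorm (m * u) ≤ C * besNorm u := by
  rw [besNorm, besNorm, upperMeanSq_rpow, upperMeanSq_rpow,
    ← ENNReal.limsup_const_mul_of_ne_top ENNReal.coe_ne_top]
  refine limsup_le_limsup (Eventually.of_forall fun n => ?_)
  refine eLpNorm_le_nnreal_smul_eLpNorm_of_ae_le_mul ?_ 2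
  have hac : ((volume (Metric.ball (0 : Euc N) n))⁻¹ • volume.restrict (Metric.ball (0 : Euc N) n))
      ≪ volume := Measure.smul_absolutelyContinuous.trans
        Measure.restrict_le_self.absolutelyContinuous
  filter_upwards [hac.ae_le hC] with y hy
  rw [Pi.mul_apply, nnnorm_mul]
  gcongr

lemma locL2_mul {m u : Euc N → ℂ} {C : ℝ≥0} (hm : AEStronglyMeasurable m)
    (hC : ∀ᵐ y, ‖m y‖₊ ≤ C) (hu : LocL2 u) : LocL2 (m * u) := by
  intro K hK
  refine MemLp.of_le_mul (c := C) (hu K hK) (hm.restrict.mul (hu K hK).aestronglyMeasurable) ?_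
  filter_upwards [ae_restrict_of_ae hC] with y hy
  rw [Pi.mul_apply, norm_mul]
  gcongr
  exact hy

lemma IsMultiplier.isBesicovitch_mul {m u : Euc N → ℂ} (hm : IsMultiplier m)
    (hu : IsBesicovitch u) : IsBesicovitch (m * u) := by
  obtain ⟨C, hC⟩ := hm.bounded
  have hmm : AEStronglyMeasurable m := LocL2.aestronglyMeasurable hm.besicovitch.locL2
  have hmL : LocL2 m := hm.besicovitch.locL2
  have huL : LocL2 u := hu.locL2
  refine .of_rpow (locL2_mul hmm hC huL) fun η hη => ?_
  obtain ⟨p, hp, h1⟩ := hu.exists_trig (η := η / 2 / (C + 1))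
    (ENNReal.div_pos (ENNReal.half_pos hη.ne').ne' (by finiteness)).ne'
  -- The order matters: the tolerance for `q` involves the sup norm of `p`, because the error is
  -- split as `m(u - p) + p(m - q)`. The added `1` avoids division by zero.
  obtain ⟨q, hq, h2⟩ := hm.besicovitch.exists_trig (η := η / 2 / (‖p‖₊ + 1))
    (ENNReal.div_pos (ENNReal.half_pos hη.ne').ne' (by finiteness)).ne'
  refine ⟨p * q, mul_mem_trig hp hq, ?_⟩
  change besNorm _ < η
  have hsplit : (m * u - fun y => (p * q) y) =
      m * (u - fun y => p y) + (fun y => p y) * (m - fun y => q y) := by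
    funext y
    simp only [Pi.sub_apply, Pi.mul_apply, Pi.add_apply, BoundedContinuousFunction.mul_apply]
    ring
  have hp' : ∀ᵐ y : Euc N, ‖p y‖₊ ≤ ‖p‖₊ :=
    Eventually.of_forall fun y => p.nnnorm_coe_le_nnnorm y
  rw [hsplit]
  refine (besNorm_add_le (locL2_mul hmm hC (huL.sub (locL2_bdd p)))
    (locL2_mul (LocL2.aestronglyMeasurable (locL2_bdd p)) hp' (hmL.sub (locL2_bdd q)))).trans_lt ?_
  rw [← ENNReal.add_halves η]
  have key : ∀ (D : ℝ≥0) (b : ℝ≥0∞), b < η / 2 / (D + 1) → D * b < η / 2 := by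
    intro D b hb
    refine lt_of_le_of_lt (mul_le_mul_left le_self_add b : (D : ℝ≥0∞) * b ≤ (D + 1) * b) ?_
    rw [mul_comm]
    exact (ENNReal.lt_div_iff_mul_lt (by simp) (by simp)).1 hb
  exact ENNReal.add_lt_add ((besNorm_mul_le hC).trans_lt (key _ _ h1))
    ((besNorm_mul_le hp').trans_lt (key _ _ h2))

/-! ### The Besicovitch space and the action of multipliers -/

namespace Besicovitch

lemma isBesicovitch (u : Besicovitch N) : IsBesicovitch (u : Euc N → ℂ) := u.2

lemma enorm_eq (u : Besicovitch N) : ‖u‖ₑ = besNorm (u : Euc N → ℂ) := by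
  rw [← ofReal_norm]
  exact ENNReal.ofReal_toReal u.isBesicovitch.besNorm_ne_top

lemma coe_sub (u v : Besicovitch N) : ((u - v : Besicovitch N) : Euc N → ℂ) = u - v := rfl

lemma coe_sum {ι : Type*} (s : Finset ι) (u : ι → Besicovitch N) :
    ((∑ i ∈ s, u i : Besicovitch N) : Euc N → ℂ) = ∑ i ∈ s, (u i : Euc N → ℂ) :=
  map_sum (besicovitchSubmodule N).subtype u s

/-- Multiplication by a multiplier on the Besicovitch space. -/
def mul {m : Euc N → ℂ} (hm : IsMultiplier m) (u : Besicovitch N) : Besicovitch N :=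
  ⟨m * (u : Euc N → ℂ), hm.isBesicovitch_mul u.isBesicovitch⟩

lemma coe_mul {m : Euc N → ℂ} (hm : IsMultiplier m) (u : Besicovitch N) :
    (mul hm u : Euc N → ℂ) = m * (u : Euc N → ℂ) := rfl

lemma exists_lipschitzWith_mul {m : Euc N → ℂ} (hm : IsMultiplier m) :
    ∃ C : ℝ≥0, LipschitzWith C (mul hm) := by
  obtain ⟨C, hC⟩ := hm.bounded
  refine ⟨C, fun u v => ?_⟩
  rw [edist_eq_enorm_sub, edist_eq_enorm_sub, enorm_eq, enorm_eq, coe_sub, coe_sub, coe_mul,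
    coe_mul, ← mul_sub]
  exact besNorm_mul_le hC

end Besicovitch

/-! ### Fourier coefficients -/

lemma meanValue_add {u v : Euc N → ℂ} (hu : IsBesicovitch u) (hv : IsBesicovitch v) :
    meanValue (u + v) = meanValue u + meanValue v :=
  (hu.hasMeanValue.add hv.hasMeanValue).meanValue_eq

lemma meanValue_sub {u v : Euc N → ℂ} (hu : IsBesicovitch u) (hv : IsBesicovitch v) :
    meanValue (u - v) = meanValue u - meanValue v :=
  (hu.hasMeanValue.sub hv.hasMeanValue).meanValue_eq

lemma meanValue_const_mul {u : Euc N → ℂ} (c : ℂ) (hu : IsBesicovitch u) :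
    meanValue (fun y => c * u y) = c * meanValue u :=
  (hu.hasMeanValue.const_mul c).meanValue_eq

lemma meanValue_sum {ι : Type*} (s : Finset ι) (u : ι → Euc N → ℂ)
    (hu : ∀ i, IsBesicovitch (u i)) :
    meanValue (∑ i ∈ s, u i) = ∑ i ∈ s, meanValue (u i) := by
  classical
  induction s using Finset.induction_on with
  | empty =>
    simpa [Pi.zero_def] using meanValue_const_mul 0 (isBesicovitch_bdd (zero_mem (trig N)))
  | insert a s ha ih =>
    rw [Finset.sum_insert ha, Finset.sum_insert ha, meanValue_add (hu a), ih]
    have : ∀ i ∈ s, u i ∈ besicovitchSubmodule N := fun i _ => hu i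
    exact Submodule.sum_mem _ this

/-- This bound serves when `m` is small only in quadratic mean; the companion bound by the essential
supremum of `m` gives continuity in `u`. -/
lemma enorm_meanValue_mul_le {m u : Euc N → ℂ} (hm : IsMultiplier m) (hu : IsBesicovitch u) :
    ‖meanValue fun y => m y * u y‖ₑ ≤ besNorm m * besNorm u :=
  (hm.isBesicovitch_mul hu).hasMeanValue.enorm_le hm.besicovitch.locL2 hu.locL2
    hm.besicovitch.besNorm_ne_top hu.besNorm_ne_top

lemma enorm_meanValue_mul_le_bound {m u : Euc N → ℂ} {C : ℝ≥0} (hm : IsMultiplier m)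
    (hC : ∀ᵐ y, ‖m y‖₊ ≤ C) (hu : IsBesicovitch u) :
    ‖meanValue fun y => m y * u y‖ₑ ≤ C * besNorm u :=
  ((hm.isBesicovitch_mul hu).hasMeanValue.enorm_le_besNorm (hm.isBesicovitch_mul hu).locL2
    (hm.isBesicovitch_mul hu).besNorm_ne_top).trans (besNorm_mul_le hC)

lemma fourierCoeff_eq (u : Euc N → ℂ) (ξ : Euc N) : fourierCoeff u ξ =
    meanValue fun y => BoundedContinuousFunction.innerProbChar (-ξ) y * u y := by
  rw [fourierCoeff]
  congr 1
  funext y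
  rw [BoundedContinuousFunction.innerProbChar_apply, real_inner_comm, inner_neg_right]
  congr 2
  push_cast
  ring

/-- `u ↦ M(m u)` is continuous on the Besicovitch space. -/
lemma exists_lipschitzWith_meanValue_mul {m : Euc N → ℂ} (hm : IsMultiplier m) :
    ∃ C : ℝ≥0, LipschitzWith C fun u : Besicovitch N => meanValue fun y => m y * u y := by
  obtain ⟨C, hC⟩ := hm.bounded
  refine ⟨C, fun u v => ?_⟩
  rw [edist_eq_enorm_sub, edist_eq_enorm_sub, Besicovitch.enorm_eq]
  have h1 := enorm_meanValue_mul_le_bound hm hC (u - v).isBesicovitch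
  have h2 := meanValue_sub (hm.isBesicovitch_mul u.isBesicovitch)
    (hm.isBesicovitch_mul v.isBesicovitch)
  rw [← mul_sub] at h2
  exact (congrArg _ h2.symm).trans_le h1

lemma continuous_meanValue_mul {m : Euc N → ℂ} (hm : IsMultiplier m) :
    Continuous fun u : Besicovitch N => meanValue fun y => m y * u y := by
  obtain ⟨C, hC⟩ := exists_lipschitzWith_meanValue_mul hm
  exact hC.continuous

lemma continuous_fourierCoeff (ξ : Euc N) :
    Continuous fun u : Besicovitch N => fourierCoeff (u : Euc N → ℂ) ξ := by
  simp only [fourierCoeff_eq]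
  exact continuous_meanValue_mul (isMultiplier_trig (char_mem_trig _))

lemma countable_spectrum_trig {p : Euc N →ᵇ ℂ} (hp : p ∈ trig N) :
    {ξ | fourierCoeff (fun y => p y) ξ ≠ 0}.Countable := by
  have hmul : ∀ (ξ : Euc N) {q : Euc N →ᵇ ℂ}, q ∈ trig N → IsBesicovitch fun y =>
      BoundedContinuousFunction.innerProbChar (-ξ) y * q y := fun ξ q hq =>
    (isMultiplier_trig (char_mem_trig (-ξ))).isBesicovitch_mul (isBesicovitch_bdd hq)
  induction hp using Submodule.span_induction with
  | mem x hx =>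
    obtain ⟨η, rfl⟩ := hx
    refine (countable_singleton η).mono fun ξ hξ => ?_
    by_contra hne
    refine hξ ?_
    rw [fourierCoeff_eq]
    have h := hasMeanValue_char (-ξ + η)
    rw [if_neg (by rwa [neg_add_eq_zero]), ← char_mul_char] at h
    exact h.meanValue_eq
  | zero =>
    refine countable_empty.mono fun ξ hξ => hξ ?_
    rw [fourierCoeff_eq]
    simpa using meanValue_const_mul 0 (isBesicovitch_bdd (zero_mem (trig N)))
  | add x y hx hy ihx ihy =>
    refine (ihx.union ihy).mono fun ξ hξ => ?_
    by_contra hne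
    simp only [mem_union, mem_ofPred_eq, not_or, not_not] at hne
    refine hξ ?_
    have := meanValue_add (hmul ξ hx) (hmul ξ hy)
    rw [← fourierCoeff_eq, ← fourierCoeff_eq, hne.1, hne.2, add_zero] at this
    rw [fourierCoeff_eq, ← this]
    simp [mul_add, Pi.add_def]
  | smul c x hx ih =>
    refine ih.mono fun ξ hξ => ?_
    by_contra hne
    rw [mem_ofPred_eq, not_not] at hne
    refine hξ ?_
    have := meanValue_const_mul c (hmul ξ hx)
    rw [← fourierCoeff_eq, hne, mul_zero] at this
    rw [fourierCoeff_eq, ← this]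
    congr 1
    funext y
    simp only [BoundedContinuousFunction.coe_smul, smul_eq_mul]
    ring

/-- The spectrum of a Besicovitch function is countable. -/
lemma Besicovitch.countable_spectrum (u : Besicovitch N) :
    {ξ | fourierCoeff (u : Euc N → ℂ) ξ ≠ 0}.Countable := by
  have happ : ∀ k : ℕ, ∃ p ∈ trig N,
      besNorm ((u : Euc N → ℂ) - fun y => p y) < ENNReal.ofReal ((1 / 2) ^ k) :=
    fun k => u.isBesicovitch.exists_trig (by simp)
  choose p hp hup using happ
  -- A frequency missing from every approximant is missing from `u`, since each Fourier coefficient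
  -- is continuous for the seminorm.
  refine (countable_iUnion fun k => countable_spectrum_trig (hp k)).mono fun ξ hξ => ?_
  by_contra hne
  simp only [mem_iUnion, mem_ofPred_eq, not_exists, not_not] at hne
  refine hξ ?_
  let P : ℕ → Besicovitch N := fun k => ⟨fun y => p k y, isBesicovitch_bdd (hp k)⟩
  have hlim : Tendsto P atTop (𝓝 u) := by
    rw [tendsto_iff_edist_tendsto_0]
    have h0 : Tendsto (fun k : ℕ => ENNReal.ofReal ((1 / 2) ^ k)) atTop (𝓝 0) := by
      rw [← ENNReal.ofReal_zero]
      exact ENNReal.tendsto_ofReal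
        (tendsto_pow_atTop_nhds_zero_of_lt_one (by norm_num) (by norm_num))
    refine tendsto_of_tendsto_of_tendsto_of_le_of_le tendsto_const_nhds h0 (fun _ => zero_le)
      fun k => ?_
    rw [edist_comm, edist_eq_enorm_sub, Besicovitch.enorm_eq, Besicovitch.coe_sub]
    exact (hup k).le
  exact tendsto_nhds_unique (((continuous_fourierCoeff ξ).tendsto u).comp hlim)
    (tendsto_const_nhds.congr fun k => (hne k).symm)

/-- A strongly measurable family of Besicovitch functions has, up to a null set, its spectrum in
one countable set. -/
lemma exists_countable_spectrum {X : Type*} [MeasurableSpace X] {μ : Measure X}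
    {v : X → Besicovitch N} (hv : AEStronglyMeasurable v μ) :
    ∃ Λ : Set (Euc N), Λ.Countable ∧
      ∀ᵐ x ∂μ, ∀ ξ ∉ Λ, fourierCoeff (v x : Euc N → ℂ) ξ = 0 := by
  -- Take the union of the spectra over a countable set `c` whose closure contains almost all
  -- values. Off this union a coefficient vanishes on `c`, hence on its closure.
  obtain ⟨t, ⟨c, hc, htc⟩, ht⟩ := hv.isSeparable_ae_range
  refine ⟨⋃ u ∈ c, {ξ | fourierCoeff (u : Euc N → ℂ) ξ ≠ 0},
    hc.biUnion fun u _ => u.countable_spectrum, ht.mono fun x hx ξ hξ => ?_⟩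
  simp only [mem_iUnion, mem_ofPred_eq, not_exists, not_not] at hξ
  have hcl : IsClosed {u : Besicovitch N | fourierCoeff (u : Euc N → ℂ) ξ = 0} :=
    isClosed_eq (continuous_fourierCoeff ξ) continuous_const
  exact closure_minimal (fun u hu => hξ u hu) hcl (htc hx)

/-- It suffices to check that a divergence vanishes one frequency at a time. -/
lemma ae_formalDiv_eq_zero {M : ℕ} {μ : Measure (Euc M)} (σ : Fin 3 → Fin N)
    {v : Euc M → Fin 3 → Besicovitch N} (hv : ∀ j, AEStronglyMeasurable (fun x => v x j) μ)
    (h : ∀ ξ, ∀ᵐ x ∂μ, formalDiv σ (fun j => v x j) ξ = 0) :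
    ∀ᵐ x ∂μ, formalDiv σ (fun j => v x j) = 0 := by
  choose Λ hΛ hae using fun j => exists_countable_spectrum (hv j)
  have h1 : ∀ᵐ x ∂μ, ∀ ξ ∈ ⋃ j, Λ j, formalDiv σ (fun j => v x j) ξ = 0 :=
    (ae_ball_iff (countable_iUnion hΛ)).2 fun ξ _ => h ξ
  filter_upwards [h1, ae_all_iff.2 hae] with x hx1 hx2
  funext ξ
  by_cases hξ : ξ ∈ ⋃ j, Λ j
  · exact hx1 ξ hξ
  · simp only [mem_iUnion, not_exists] at hξ
    exact Finset.sum_eq_zero fun j _ => by rw [hx2 j ξ (hξ j), mul_zero]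

/-! ### Periodic functions are multipliers -/

/-- The measure on the circle of length one is the Haar probability measure, as in
`UnitAddTorus.lintegral_preimage`. -/
noncomputable local instance unitCircleMeasureSpace : MeasureSpace UnitAddCircle :=
  ⟨AddCircle.haarAddCircle⟩

local instance unitCircle_isAddHaarMeasure :
    Measure.IsAddHaarMeasure (volume : Measure UnitAddCircle) :=
  inferInstanceAs (Measure.IsAddHaarMeasure AddCircle.haarAddCircle)

local instance unitCircle_isProbabilityMeasure :
    IsProbabilityMeasure (volume : Measure UnitAddCircle) :=
  inferInstanceAs (IsProbabilityMeasure AddCircle.haarAddCircle)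

/-- The half-open unit cube. -/
def unitCube (N : ℕ) : Set (Euc N) := {y | ∀ i, y i ∈ Ioc (0 : ℝ) (0 + 1)}

lemma measurableSet_unitCube : MeasurableSet (unitCube N) := by
  have : unitCube N = ⋂ i, (fun y : Euc N => y i) ⁻¹' Ioc (0 : ℝ) (0 + 1) := by
    ext y; simp [unitCube]
  rw [this]
  exact MeasurableSet.iInter fun i => measurableSet_Ioc.preimage (by fun_prop)

lemma lintegral_torus (f : UnitAddTorus (Fin N) → ℝ≥0∞) :
    ∫⁻ t, f t = ∫⁻ y in unitCube N, f fun i => (y i : UnitAddCircle) := by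
  rw [UnitAddTorus.lintegral_preimage f 0]
  exact ((PiLp.volume_preserving_ofLp (Fin N)).setLIntegral_comp_preimage_emb
    (MeasurableEquiv.toLp 2 (Fin N → ℝ)).symm.measurableEmbedding
    (fun x => f fun i => (x i : UnitAddCircle)) _).symm

/-- The periods of `w` form an additive subgroup, which contains the integer lattice as soon as it
contains the unit vectors. -/
lemma periodic_int {w : Euc N → ℂ} (hw : ∀ k y, w (y + EuclideanSpace.single k 1) = w y)
    (k : Fin N → ℤ) (y : Euc N) : w (y + WithLp.toLp 2 fun i => (k i : ℝ)) = w y := by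
  let G : AddSubgroup (Euc N) :=
    { carrier := {v | ∀ y, w (y + v) = w y}
      zero_mem' := fun y => by rw [add_zero]
      add_mem' := fun {a b} ha hb y => by rw [← add_assoc, hb, ha]
      neg_mem' := fun {a} ha y => by rw [← ha, neg_add_cancel_right] }
  have h : (WithLp.toLp 2 fun i => (k i : ℝ) : Euc N) =
      ∑ i, k i • (EuclideanSpace.single i 1 : Euc N) := by
    ext j
    simp [Pi.single_apply]
  have hmem : (WithLp.toLp 2 fun i => (k i : ℝ) : Euc N) ∈ G := by
    rw [h]
    exact sum_mem fun i _ => zsmul_mem (show EuclideanSpace.single i 1 ∈ G from hw i) _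
  exact hmem y

lemma setLIntegral_unitCube_translate {w : Euc N → ℂ}
    (hw : ∀ k y, w (y + EuclideanSpace.single k 1) = w y) (k : Fin N → ℤ) :
    ∫⁻ y in {y | y - (WithLp.toLp 2 fun i => (k i : ℝ)) ∈ unitCube N}, ‖w y‖ₑ ^ 2 =
      ∫⁻ y in unitCube N, ‖w y‖ₑ ^ 2 := by
  set v : Euc N := WithLp.toLp 2 fun i => (k i : ℝ) with hv
  have h := (measurePreserving_sub_right (volume : Measure (Euc N)) v).setLIntegral_comp_preimage_emb
    (measurableEmbedding_subRight v) (fun y => ‖w y‖ₑ ^ 2) (unitCube N)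
  rw [← h]
  refine setLIntegral_congr_fun_ae (measurableSet_unitCube.preimage (by fun_prop)) ?_
  refine Eventually.of_forall fun y _ => ?_
  have := periodic_int hw k (y - v)
  rw [← hv, sub_add_cancel] at this
  rw [this]

lemma ball_subset_cubes {n : ℕ} : Metric.ball (0 : Euc N) n ⊆
    ⋃ k : Fintype.piFinset fun _ : Fin N => Finset.Ico (-n : ℤ) n,
      {y | y - (WithLp.toLp 2 fun i => (k.1 i : ℝ)) ∈ unitCube N} := by
  intro y hy
  rw [mem_ball_zero_iff] at hy
  have hc : ∀ i, |y i| < n := fun i => (PiLp.norm_apply_le y i).trans_lt hy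
  -- The cubes are open on the left and closed on the right, so the index is the ceiling minus one
  -- rather than the floor.
  refine mem_iUnion.2 ⟨⟨fun i => ⌈y i⌉ - 1, ?_⟩, fun i => ?_⟩
  · refine Fintype.mem_piFinset.2 fun i => Finset.mem_Ico.2 ?_
    obtain ⟨h1, h2⟩ := abs_lt.1 (hc i)
    have h3 : (-n : ℤ) < ⌈y i⌉ := Int.lt_ceil.2 (by push_cast; exact h1)
    have h4 : ⌈y i⌉ ≤ (n : ℤ) := Int.ceil_le.2 (by push_cast; exact h2.le)
    omega
  · have h1 := Int.le_ceil (y i)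
    have h2 := Int.ceil_lt_add_one (y i)
    simp only [PiLp.sub_apply, mem_Ioc]
    push_cast
    constructor <;> linarith

/-- The ball of radius `n` is covered by `(2n)^N` lattice translates of the cell, each carrying the
same integral, while its volume is `n^N |B_1|`; the powers of `n` cancel. -/
lemma exists_upperMeanSq_le_unitCube (N : ℕ) : ∃ D : ℝ≥0∞, D ≠ ∞ ∧ ∀ w : Euc N → ℂ,
    (∀ k y, w (y + EuclideanSpace.single k 1) = w y) →
      upperMeanSq w ≤ D * ∫⁻ y in unitCube N, ‖w y‖ₑ ^ 2 := by
  have hB0 : volume (Metric.ball (0 : Euc N) 1) ≠ 0 :=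
    (Metric.measure_ball_pos volume _ one_pos).ne'
  have hB1 : volume (Metric.ball (0 : Euc N) 1) ≠ ∞ := measure_ball_lt_top.ne
  refine ⟨2 ^ N * (volume (Metric.ball (0 : Euc N) 1))⁻¹,
    ENNReal.mul_ne_top (by finiteness) (by simpa using hB0), fun w hw => ?_⟩
  refine limsup_le_of_le (by isBoundedDefault) ?_
  filter_upwards [eventually_ne_atTop 0] with n hn
  have h1 : ∫⁻ y in Metric.ball (0 : Euc N) n, ‖w y‖ₑ ^ 2 ≤
      (2 * n) ^ N * ∫⁻ y in unitCube N, ‖w y‖ₑ ^ 2 := by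
    refine (lintegral_mono_set ball_subset_cubes).trans ((lintegral_iUnion_le _ _).trans ?_)
    simp only [setLIntegral_unitCube_translate hw, tsum_fintype, Finset.sum_const,
      Finset.card_univ, Fintype.card_coe, Fintype.card_piFinset, Int.card_Ico, nsmul_eq_mul,
      Finset.prod_const, Fintype.card_fin]
    have : ((n : ℤ) - -(n : ℤ)).toNat = 2 * n := by omega
    rw [this]
    push_cast
    exact le_rfl
  have hvol : volume (Metric.ball (0 : Euc N) n) =
      (n : ℝ≥0∞) ^ N * volume (Metric.ball (0 : Euc N) 1) := by
    have h2 := smul_ball_zero (N := N) hn 1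
    rw [mul_one] at h2
    rw [← h2, Measure.addHaar_smul, finrank_euclideanSpace_fin, abs_of_nonneg (by positivity),
      ENNReal.ofReal_pow (by positivity), ENNReal.ofReal_natCast]
  have hnN0 : (n : ℝ≥0∞) ^ N ≠ 0 := pow_ne_zero _ (by exact_mod_cast hn)
  have hnN1 : (n : ℝ≥0∞) ^ N ≠ ∞ := by finiteness
  calc _ ≤ (volume (Metric.ball (0 : Euc N) n))⁻¹ *
        ((2 * n) ^ N * ∫⁻ y in unitCube N, ‖w y‖ₑ ^ 2) := by gcongr
    _ = ((n : ℝ≥0∞) ^ N * ((n : ℝ≥0∞) ^ N)⁻¹) * (2 ^ N *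
        (volume (Metric.ball (0 : Euc N) 1))⁻¹ * ∫⁻ y in unitCube N, ‖w y‖ₑ ^ 2) := by
        rw [hvol, ENNReal.mul_inv (Or.inl hnN0) (Or.inl hnN1), mul_pow]
        ring
    _ ≤ _ := by rw [ENNReal.mul_inv_cancel hnN0 hnN1, one_mul]

lemma mFourier_coe (k : Fin N → ℤ) (y : Euc N) :
    UnitAddTorus.mFourier k (fun i => (y i : UnitAddCircle)) =
      BoundedContinuousFunction.innerProbChar
        (WithLp.toLp 2 fun i => 2 * Real.pi * (k i : ℝ) : Euc N) y := by
  rw [BoundedContinuousFunction.innerProbChar_apply]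
  simp only [UnitAddTorus.mFourier, ContinuousMap.coe_mk, fourier_coe_apply, ← Complex.exp_sum]
  congr 1
  simp only [PiLp.inner_apply, RCLike.inner_apply, conj_trivial]
  push_cast
  rw [Finset.sum_mul]
  refine Finset.sum_congr rfl fun i _ => ?_
  simp
  ring

/-- Elements of `Lp` are only classes; carrying a continuous representative through the induction
identifies the lift to `ℝ^N` with a trigonometric polynomial at every point. -/
lemma exists_trig_of_mem_span {q : Lp ℂ 2 (volume : Measure (UnitAddTorus (Fin N)))}
    (hq : q ∈ Submodule.span ℂ (range (UnitAddTorus.mFourierLp (d := Fin N) 2))) :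
    ∃ G : C(UnitAddTorus (Fin N), ℂ), q = ContinuousMap.toLp 2 volume ℂ G ∧
      ∃ g ∈ trig N, ∀ y : Euc N, G (fun i => (y i : UnitAddCircle)) = g y := by
  induction hq using Submodule.span_induction with
  | mem x hx =>
    obtain ⟨k, rfl⟩ := hx
    exact ⟨_, rfl, _, char_mem_trig _, mFourier_coe k⟩
  | zero => exact ⟨0, by simp, 0, zero_mem _, fun y => by simp⟩
  | add x y _ _ hx hy =>
    obtain ⟨G, rfl, g, hg, h⟩ := hx
    obtain ⟨G', rfl, g', hg', h'⟩ := hy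
    exact ⟨G + G', by simp, g + g', add_mem hg hg', fun y => by simp [h, h']⟩
  | smul c x _ hx =>
    obtain ⟨G, rfl, g, hg, h⟩ := hx
    exact ⟨c • G, by simp, c • g, Submodule.smul_mem _ c hg, fun y => by simp [h]⟩

lemma trig_periodic_of_torus {G : C(UnitAddTorus (Fin N), ℂ)} {g : Euc N →ᵇ ℂ}
    (h : ∀ y : Euc N, G (fun i => (y i : UnitAddCircle)) = g y) (k : Fin N) (y : Euc N) :
    g (y + EuclideanSpace.single k 1) = g y := by
  rw [← h, ← h]
  congr 1
  funext i
  by_cases hi : i = k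
  · subst hi
    simp
  · simp [hi]

/-- The values of `m` on one cell define a square integrable function on the torus, where Fourier
monomials span a dense subspace of `L²`. -/
lemma exists_trig_unitCube {m : Euc N → ℂ} (hm : MemLp m ∞ volume) {δ : ℝ≥0∞} (hδ : δ ≠ 0) :
    ∃ g ∈ trig N, (∀ k y, g (y + EuclideanSpace.single k 1) = g y) ∧
      ∫⁻ y in unitCube N, ‖m y - g y‖ₑ ^ 2 < δ := by
  -- A genuinely measurable representative makes the function on the torus measurable by
  -- composition.
  obtain ⟨m₀, hm₀, hmm₀⟩ := hm.aestronglyMeasurable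
  let F : UnitAddTorus (Fin N) → ℂ := fun t =>
    m₀ (WithLp.toLp 2 (UnitAddTorus.measurableEquivPiIoc (0 : Fin N → ℝ) t).1)
  have hFmeas : Measurable F := hm₀.measurable.comp ((MeasurableEquiv.toLp 2 _).measurable.comp
    (measurable_subtype_coe.comp (UnitAddTorus.measurableEquivPiIoc _).measurable))
  have hFy : ∀ y ∈ unitCube N, F (fun i => (y i : UnitAddCircle)) = m₀ y := by
    intro y hy
    have h := (UnitAddTorus.measurableEquivPiIoc (0 : Fin N → ℝ)).apply_symm_apply ⟨y.ofLp, hy⟩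
    rw [UnitAddTorus.coe_symm_measurableEquivPiIoc_apply] at h
    simp only [F]
    rw [h]
  have hcube : ∀ G : UnitAddTorus (Fin N) → ℂ, ∫⁻ t, ‖F t - G t‖ₑ ^ 2 =
      ∫⁻ y in unitCube N, ‖m y - G fun i => (y i : UnitAddCircle)‖ₑ ^ 2 := by
    intro G
    rw [lintegral_torus]
    refine setLIntegral_congr_fun_ae measurableSet_unitCube ?_
    filter_upwards [hmm₀] with y hy hyQ
    rw [hFy y hyQ, hy]
  have hnorm : ∀ w : UnitAddTorus (Fin N) → ℂ, eLpNorm w 2 volume =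
      (∫⁻ t, ‖w t‖ₑ ^ 2) ^ (1 / 2 : ℝ) := by
    intro w
    rw [eLpNorm_eq_lintegral_rpow_enorm_toReal two_ne_zero ENNReal.ofNat_ne_top]
    simp
  have hvol : volume (unitCube N) ≠ ∞ := by
    have := lintegral_torus (N := N) fun _ => 1
    simp only [lintegral_const, measure_univ, one_mul,
      Measure.restrict_apply_univ] at this
    rw [← this]
    exact ENNReal.one_ne_top
  have hF : MemLp F 2 volume := by
    refine ⟨hFmeas.aestronglyMeasurable, ?_⟩
    rw [hnorm]
    refine ENNReal.rpow_lt_top_of_nonneg (by norm_num) (ne_of_lt ?_)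
    have := hcube 0
    simp only [Pi.zero_apply, sub_zero] at this
    rw [this]
    calc ∫⁻ y in unitCube N, ‖m y‖ₑ ^ 2
        ≤ ∫⁻ y in unitCube N, eLpNorm m ∞ volume ^ 2 := by
          refine lintegral_mono_ae (ae_restrict_of_ae ?_)
          filter_upwards [enorm_ae_le_eLpNormEssSup m volume] with y hy
          rw [eLpNorm_exponent_top]
          gcongr
      _ < ∞ := by
          rw [setLIntegral_const]
          exact ENNReal.mul_lt_top (ENNReal.pow_lt_top hm.2) hvol.lt_top
  have hcl : hF.toLp F ∈ (Submodule.span ℂ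
      (range (UnitAddTorus.mFourierLp (d := Fin N) 2))).topologicalClosure := by
    rw [UnitAddTorus.span_mFourierLp_closure_eq_top (by simp)]
    trivial
  obtain ⟨q, hq, hdist⟩ := EMetric.mem_closure_iff.1 hcl (δ ^ (1 / 2 : ℝ))
    (ENNReal.rpow_pos_of_nonneg (pos_iff_ne_zero.2 hδ) (by norm_num))
  obtain ⟨G, rfl, g, hg, hGg⟩ := exists_trig_of_mem_span hq
  refine ⟨g, hg, trig_periodic_of_torus hGg, ?_⟩
  have he : edist (hF.toLp F) (ContinuousMap.toLp 2 volume ℂ G) =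
      eLpNorm (fun t => F t - G t) 2 volume := by
    rw [Lp.edist_def]
    refine eLpNorm_congr_ae ?_
    filter_upwards [hF.coeFn_toLp, ContinuousMap.coeFn_toLp (p := 2) (𝕜 := ℂ) volume G]
      with t h1 h2
    rw [Pi.sub_apply, h1, h2]
  rw [he, hnorm, hcube, ENNReal.rpow_lt_rpow_iff (by norm_num)] at hdist
  simpa only [hGg] using hdist

/-- The approximant is chosen with the same periods as `m`, so the error is periodic and its
quadratic mean over large balls is controlled by its `L²` norm on one cell. -/
lemma isMultiplier_of_periodic {m : Euc N → ℂ} (hm : MemLp m ∞ volume)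
    (hper : ∀ k y, m (y + EuclideanSpace.single k 1) = m y) : IsMultiplier m := by
  have hbd : ∀ᵐ y, ‖m y‖₊ ≤ (eLpNorm m ∞ volume).toNNReal := by
    filter_upwards [enorm_ae_le_eLpNormEssSup m volume] with y hy
    rw [← eLpNorm_exponent_top] at hy
    have := ENNReal.toNNReal_mono hm.2.ne hy
    simpa using this
  refine ⟨⟨fun K hK => ?_, fun δ hδ => ?_⟩, _, hbd⟩
  · have : IsFiniteMeasure (volume.restrict K) := ⟨by simpa using hK.measure_lt_top⟩
    exact hm.restrict K |>.mono_exponent le_top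
  · obtain ⟨D, hD, h⟩ := exists_upperMeanSq_le_unitCube N
    obtain ⟨g, hg, hgper, hlt⟩ := exists_trig_unitCube hm (δ := δ / (D + 1))
      (ENNReal.div_pos hδ.ne' (by finiteness)).ne'
    refine ⟨g, hg, (h _ fun k y => by rw [hper, hgper]).trans_lt ?_⟩
    refine (mul_le_mul_left le_self_add _ : _ ≤ (D + 1) * _).trans_lt ?_
    rw [mul_comm]
    exact (ENNReal.lt_div_iff_mul_lt (by simp) (Or.inl (by finiteness))).1 hlt

/-! ### Oscillating functions on bounded sets -/

lemma eLpNorm_comp_smul_le {e : ℝ} (he : 0 < e) {k : ℕ} (hk : k ≠ 0) {R : ℝ} (hR : R ≤ e * k)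
    (w : Euc N → ℂ) : eLpNorm (fun x => w (e⁻¹ • x)) 2 (volume.restrict (Metric.ball 0 R)) ≤
      volume (Metric.ball (0 : Euc N) (e * k)) ^ (1 / 2 : ℝ) *
        eLpNorm w 2 (avgOn (Metric.ball (0 : Euc N) k)) := by
  have he' : e⁻¹ ≠ 0 := inv_ne_zero he.ne'
  have hemb : MeasurableEmbedding fun x : Euc N => e⁻¹ • x := measurableEmbedding_const_smul₀ he'
  have hpre : Metric.ball (0 : Euc N) R ⊆ (fun x : Euc N => e⁻¹ • x) ⁻¹' Metric.ball 0 k := by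
    intro x hx
    rw [mem_ball_zero_iff] at hx
    rw [mem_preimage, mem_ball_zero_iff, norm_smul, norm_inv, Real.norm_of_nonneg he.le,
      inv_mul_lt_iff₀ he]
    exact hx.trans_le hR
  have hB0 : volume (Metric.ball (0 : Euc N) k) ≠ 0 :=
    (Metric.measure_ball_pos volume _ (by exact_mod_cast Nat.pos_of_ne_zero hk)).ne'
  have hB1 : volume (Metric.ball (0 : Euc N) k) ≠ ∞ := measure_ball_lt_top.ne
  have hscale : volume (Metric.ball (0 : Euc N) (e * k)) =
      ENNReal.ofReal |((e⁻¹ : ℝ) ^ Module.finrank ℝ (Euc N))⁻¹| *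
        volume (Metric.ball (0 : Euc N) k) := by
    rw [inv_pow, inv_inv, ← Measure.addHaar_smul, smul_ball he.ne', smul_zero,
      Real.norm_of_nonneg he.le]
  calc eLpNorm (fun x => w (e⁻¹ • x)) 2 (volume.restrict (Metric.ball 0 R))
      ≤ eLpNorm (w ∘ fun x : Euc N => e⁻¹ • x) 2
          (volume.restrict ((fun x : Euc N => e⁻¹ • x) ⁻¹' Metric.ball 0 k)) :=
        eLpNorm_mono_measure _ (Measure.restrict_mono hpre le_rfl)
    _ = eLpNorm w 2 (volume (Metric.ball (0 : Euc N) (e * k)) •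
          avgOn (Metric.ball (0 : Euc N) k)) := by
        rw [← hemb.eLpNorm_map_measure, ← hemb.restrict_map, Measure.map_addHaar_smul _ he',
          Measure.restrict_smul, avgOn, smul_smul, hscale, mul_assoc,
          ENNReal.mul_inv_cancel hB0 hB1, mul_one]
    _ = _ := by
        rw [eLpNorm_smul_measure_of_ne_top (by simp)]
        simp

/-- This converts smallness in the Besicovitch seminorm into smallness in `L²` of a fixed ball,
after oscillation. The ball of radius `R` is rescaled into one of integer radius `k = ⌈R/ε⌉`; since
`εk ≤ R + 1` once `ε < 1`, the constant `|B_{R+1}|^{1/2}` works for every `w`. -/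
lemma exists_eventually_eLpNorm_comp_smul_le (N : ℕ) {ε : ℕ → ℝ} (hpos : ∀ n, 0 < ε n)
    (hε : Tendsto ε atTop (𝓝 0)) {R : ℝ} (hR : 0 < R) : ∃ C : ℝ≥0∞, C ≠ ∞ ∧
      ∀ (w : Euc N → ℂ) (η : ℝ≥0∞), besNorm w < η → ∀ᶠ n in atTop,
        eLpNorm (fun x => w ((ε n)⁻¹ • x)) 2 (volume.restrict (Metric.ball 0 R)) ≤ C * η := by
  refine ⟨volume (Metric.ball (0 : Euc N) (R + 1)) ^ (1 / 2 : ℝ),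
    ENNReal.rpow_ne_top_of_nonneg (by norm_num) measure_ball_lt_top.ne, fun w η hη => ?_⟩
  have hinv : Tendsto (fun n => R * (ε n)⁻¹) atTop atTop :=
    (tendsto_inv_nhdsGT_zero.comp (tendsto_nhdsWithin_iff.2
      ⟨hε, Eventually.of_forall hpos⟩)).const_mul_atTop hR
  have hk := (tendsto_nat_ceil_atTop (α := ℝ)).comp hinv
  filter_upwards [hk.eventually (eventually_eLpNorm_lt hη), hk.eventually (eventually_ne_atTop 0),
    hε.eventually_lt_const one_pos] with n h1 h2 h3
  simp only [Function.comp_apply] at h1 h2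
  have h4 := Nat.le_ceil (R * (ε n)⁻¹)
  have h5 := Nat.ceil_lt_add_one (mul_pos hR (inv_pos.2 (hpos n))).le
  refine (eLpNorm_comp_smul_le (hpos n) h2 ?_ w).trans ?_
  · rwa [← div_eq_mul_inv, div_le_iff₀ (hpos n), mul_comm] at h4
  · gcongr
    rw [← div_eq_mul_inv] at h5 ⊢
    calc ε n * (⌈R / ε n⌉₊ : ℝ) ≤ ε n * (R / ε n + 1) := by
          have := (hpos n).le
          gcongr
      _ = R + ε n := by
          have := (hpos n).ne'
          field_simp
      _ ≤ R + 1 := by linarith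

lemma aestronglyMeasurable_comp_smul {w : Euc N → ℂ} (hw : AEStronglyMeasurable w) {c : ℝ}
    (hc : c ≠ 0) : AEStronglyMeasurable fun x => w (c • x) :=
  hw.comp_quasiMeasurePreserving (Measure.quasiMeasurePreserving_smul volume hc)

lemma ae_comp_smul {q : Euc N → Prop} (hq : ∀ᵐ y, q y) {c : ℝ} (hc : c ≠ 0) :
    ∀ᵐ x : Euc N, q (c • x) :=
  (Measure.quasiMeasurePreserving_smul volume hc).ae hq

lemma memLp_mul_bounded {μ : Measure (Euc N)} {u b : Euc N → ℂ} {C : ℝ≥0} (hu : MemLp u 2 μ)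
    (hb : AEStronglyMeasurable b μ) (hC : ∀ᵐ x ∂μ, ‖b x‖₊ ≤ C) :
    MemLp (fun x => b x * u x) 2 μ := by
  refine hu.of_le_mul (c := C) (hb.mul hu.aestronglyMeasurable) ?_
  filter_upwards [hC] with x hx
  rw [norm_mul]
  gcongr
  exact hx

lemma integrable_mul_test {Ω : Set (Euc N)} {u φ b : Euc N → ℂ} {C : ℝ≥0}
    (hu : MemLp u 2 (volume.restrict Ω)) (hφ : Continuous φ) (hφc : HasCompactSupport φ)
    (hb : AEStronglyMeasurable b) (hC : ∀ᵐ x, ‖b x‖₊ ≤ C) :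
    Integrable (fun x => u x * (φ x * b x)) (volume.restrict Ω) := by
  have h := memLp_mul_bounded (hφ.memLp_of_hasCompactSupport (p := 2) (μ := volume.restrict Ω) hφc)
    hb.restrict (ae_restrict_of_ae hC)
  have := hu.integrable_mul h
  refine this.congr (Eventually.of_forall fun x => ?_)
  simp only [Pi.mul_apply]
  ring

lemma integrable_mul_trig {Ω : Set (Euc N)} {u φ : Euc N → ℂ}
    (hu : MemLp u 2 (volume.restrict Ω)) (hφ : Continuous φ) (hφc : HasCompactSupport φ)
    (p : Euc N →ᵇ ℂ) {c : ℝ} (hc : c ≠ 0) :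
    Integrable (fun x => u x * (φ x * p (c • x))) (volume.restrict Ω) :=
  integrable_mul_test (C := ‖p‖₊) hu hφ hφc
    (aestronglyMeasurable_comp_smul p.continuous.aestronglyMeasurable hc)
    (Eventually.of_forall fun _ => p.nnnorm_coe_le_nnnorm _)

/-! ### Two-scale convergence tested with `φ(x) p(y)`, `p` a trigonometric polynomial -/

/-- Two-scale convergence for the test functions `φ(x) p(y)` with `φ` continuous and compactly
supported in `Ω` and `p` a trigonometric polynomial. -/
def TrigTendsto (Ω : Set (Euc N)) (ε : ℕ → ℝ) (u : ℕ → Euc N → ℂ)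
    (v : Euc N → Besicovitch N) : Prop :=
  ∀ φ : Euc N → ℂ, Continuous φ → HasCompactSupport φ → tsupport φ ⊆ Ω → ∀ p ∈ trig N,
    Tendsto (fun n => ∫ x in Ω, u n x * (φ x * p ((ε n)⁻¹ • x))) atTop
      (𝓝 (∫ x in Ω, φ x * meanValue fun y => p y * v x y))

lemma TwoScaleTendsto.trigTendsto {Ω : Set (Euc N)} {ε : ℕ → ℝ} {u : ℕ → Euc N → ℂ}
    {v : Euc N → Besicovitch N} (h : TwoScaleTendsto Ω ε u v) : TrigTendsto Ω ε u v := by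
  intro φ hφ hφc hφΩ p hp
  have := h.tendsto (fun x => φ x • p) (hφ.smul continuous_const) hφc.smul_right
    ((tsupport_smul_subset_left φ _).trans hφΩ)
    fun x => Submodule.smul_mem _ _ (Submodule.le_topologicalClosure _ hp)
  refine (this.congr fun n => rfl) |>.mono_right (le_of_eq <| congrArg 𝓝 (integral_congr_ae ?_))
  refine Eventually.of_forall fun x => ?_
  have hb := (isMultiplier_trig hp).isBesicovitch_mul (v x).isBesicovitch
  have h2 := meanValue_const_mul (φ x) hb
  refine Eq.trans ?_ h2
  simp only
  congr 1
  funext y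
  simp only [Pi.mul_apply, BoundedContinuousFunction.coe_smul, smul_eq_mul]
  ring

lemma memLp_meanValue_mul {μ : Measure (Euc N)} {v : Euc N → Besicovitch N} (hv : MemLp v 2 μ)
    {m : Euc N → ℂ} (hm : IsMultiplier m) :
    MemLp (fun x => meanValue fun y => m y * v x y) 2 μ := by
  obtain ⟨C, hC⟩ := hm.bounded
  refine hv.of_enorm_le_mul (c := C)
    ((continuous_meanValue_mul hm).comp_aestronglyMeasurable hv.aestronglyMeasurable)
    (Eventually.of_forall fun x => ?_)
  rw [Besicovitch.enorm_eq]
  exact enorm_meanValue_mul_le_bound hm hC (v x).isBesicovitch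

lemma integrable_test_meanValue {Ω : Set (Euc N)} {v : Euc N → Besicovitch N}
    (hv : MemLp v 2 (volume.restrict Ω)) {φ : Euc N → ℂ} (hφ : Continuous φ)
    (hφc : HasCompactSupport φ) {m : Euc N → ℂ} (hm : IsMultiplier m) :
    Integrable (fun x => φ x * meanValue fun y => m y * v x y) (volume.restrict Ω) :=
  (hφ.memLp_of_hasCompactSupport (p := 2) hφc).integrable_mul (memLp_meanValue_mul hv hm)

lemma memLp_besicovitch_mul {μ : Measure (Euc N)} {v : Euc N → Besicovitch N} (hv : MemLp v 2 μ)
    {m : Euc N → ℂ} (hm : IsMultiplier m) : MemLp (fun x => Besicovitch.mul hm (v x)) 2 μ := by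
  obtain ⟨C, hC⟩ := hm.bounded
  obtain ⟨C', hC'⟩ := Besicovitch.exists_lipschitzWith_mul hm
  refine hv.of_enorm_le_mul (c := C)
    (hC'.continuous.comp_aestronglyMeasurable hv.aestronglyMeasurable)
    (Eventually.of_forall fun x => ?_)
  rw [Besicovitch.enorm_eq, Besicovitch.enorm_eq]
  exact besNorm_mul_le hC

lemma memLp_besicovitch_sum {μ : Measure (Euc N)} {ι : Type*} (s : Finset ι)
    {v : ι → Euc N → Besicovitch N} (hv : ∀ i, MemLp (v i) 2 μ) :
    MemLp (fun x => ∑ i ∈ s, v i x) 2 μ := by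
  have hn : ∀ i, MemLp (fun x => ‖v i x‖) 2 μ := fun i =>
    (hv i).of_enorm_le_mul (c := 1) (hv i).aestronglyMeasurable.norm
      (Eventually.of_forall fun x => by simp)
  have hs : MemLp (fun x => ∑ i ∈ s, ‖v i x‖) 2 μ := memLp_finsetSum s fun i _ => hn i
  refine hs.of_le_enorm (s.aestronglyMeasurable_fun_sum fun i _ => (hv i).aestronglyMeasurable)
    (Eventually.of_forall fun x => ?_)
  rw [enorm_le_iff_norm_le, Real.norm_of_nonneg (Finset.sum_nonneg fun i _ => norm_nonneg _)]
  exact norm_sum_le s fun i => v i x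

lemma TrigTendsto.sum {Ω : Set (Euc N)} {ε : ℕ → ℝ} (hpos : ∀ n, 0 < ε n) {ι : Type*}
    (s : Finset ι) {u : ι → ℕ → Euc N → ℂ} {v : ι → Euc N → Besicovitch N}
    (hu : ∀ i n, MemLp (u i n) 2 (volume.restrict Ω)) (hv : ∀ i, MemLp (v i) 2 (volume.restrict Ω))
    (h : ∀ i, TrigTendsto Ω ε (u i) (v i)) :
    TrigTendsto Ω ε (fun n x => ∑ i ∈ s, u i n x) fun x => ∑ i ∈ s, v i x := by
  intro φ hφ hφc hφΩ p hp
  have h1 := tendsto_finsetSum s fun i _ => h i φ hφ hφc hφΩ p hp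
  rw [← integral_finsetSum s fun i _ => integrable_test_meanValue (hv i) hφ hφc
    (isMultiplier_trig hp)] at h1
  have h2 : ∀ n, (∫ x in Ω, (∑ i ∈ s, u i n x) * (φ x * p ((ε n)⁻¹ • x))) =
      ∑ i ∈ s, ∫ x in Ω, u i n x * (φ x * p ((ε n)⁻¹ • x)) := by
    intro n
    rw [← integral_finsetSum s fun i _ => integrable_mul_trig (hu i n) hφ hφc p
      (inv_ne_zero (hpos n).ne')]
    simp only [Finset.sum_mul]
  simp only [h2]
  convert h1 using 2
  refine integral_congr_ae (Eventually.of_forall fun x => ?_)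
  simp only
  have hsum := meanValue_sum s (fun i y => p y * v i x y) fun i =>
    (isMultiplier_trig hp).isBesicovitch_mul (v i x).isBesicovitch
  rw [← Finset.mul_sum, ← hsum]
  congr 2
  funext y
  have := congrFun (Besicovitch.coe_sum s fun i => v i x) y
  rw [this]
  simp [Finset.mul_sum]

/-- A three-term approximation argument: `J` and `B` may depend on `η`, but `C` may not. -/
lemma tendsto_of_enorm_approx {I : ℕ → ℂ} {A : ℂ} {C : ℝ≥0∞} (hC : C ≠ ∞)
    (h : ∀ η : ℝ≥0∞, η ≠ 0 → η ≠ ∞ → ∃ (J : ℕ → ℂ) (B : ℂ), Tendsto J atTop (𝓝 B) ∧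
      (∀ᶠ n in atTop, ‖I n - J n‖ₑ ≤ C * η) ∧ ‖A - B‖ₑ ≤ C * η) : Tendsto I atTop (𝓝 A) := by
  refine EMetric.tendsto_nhds.2 fun e he => ?_
  have he3 : e / 3 ≠ 0 := (ENNReal.div_pos he.ne' (by simp)).ne'
  -- The cap at `1` keeps the tolerance finite even when `e = ∞`, as the strict inequality below
  -- requires.
  obtain ⟨J, B, hJ, hIJ, hAB⟩ := h (min (e / 3) 1 / (C + 1))
    (ENNReal.div_pos (lt_min (pos_iff_ne_zero.2 he3) one_pos).ne' (by finiteness)).ne'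
    (ENNReal.div_ne_top (ne_top_of_le_ne_top ENNReal.one_ne_top (min_le_right _ _)) (by simp))
  have hη : C * (min (e / 3) 1 / (C + 1)) ≤ min (e / 3) 1 := by
    rw [← mul_div_assoc]
    refine ENNReal.div_le_of_le_mul ?_
    rw [mul_comm]
    gcongr
    exact le_self_add
  filter_upwards [hIJ, EMetric.tendsto_nhds.1 hJ (e / 3) (pos_iff_ne_zero.2 he3)] with n h1 h2
  have hfin : min (e / 3) 1 ≠ ∞ := ne_top_of_le_ne_top ENNReal.one_ne_top (min_le_right _ _)
  calc edist (I n) A ≤ edist (I n) (J n) + edist (J n) B + edist B A := edist_triangle4 _ _ _ _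
    _ < min (e / 3) 1 + e / 3 + min (e / 3) 1 := by
        rw [edist_eq_enorm_sub, edist_comm B, edist_eq_enorm_sub A]
        exact ENNReal.add_lt_add_of_lt_of_le (ne_top_of_le_ne_top hfin (hAB.trans hη))
          (ENNReal.add_lt_add_of_le_of_lt (ne_top_of_le_ne_top hfin (h1.trans hη))
            (h1.trans hη) h2) (hAB.trans hη)
    _ ≤ e / 3 + e / 3 + e / 3 := by gcongr <;> exact min_le_left _ _
    _ = e := ENNReal.add_thirds e

lemma IsMultiplier.sub_trig {m : Euc N → ℂ} (hm : IsMultiplier m) {q : Euc N →ᵇ ℂ}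
    (hq : q ∈ trig N) : IsMultiplier fun y => m y - q y := by
  obtain ⟨C, hC⟩ := hm.bounded
  refine ⟨?_, C + ‖q‖₊, ?_⟩
  · have h := hm.besicovitch.add ((isBesicovitch_bdd hq).smul (-1))
    convert h using 1
    funext y
    simp [sub_eq_add_neg]
  · filter_upwards [hC] with y hy
    exact (nnnorm_sub_le _ _).trans (add_le_add hy (q.nnnorm_coe_le_nnnorm y))

/-- Cauchy–Schwarz with `φ` and `p` taken in sup norm, so that `w` enters only through its `L²` norm
on a ball containing the support of `φ`. -/
lemma enorm_integral_osc_le {Ω : Set (Euc N)} {u φ w : Euc N → ℂ} {R : ℝ} {K : ℝ≥0}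
    (hu : MemLp u 2 (volume.restrict Ω)) (hφ : Continuous φ) (hK : ∀ x, ‖φ x‖₊ ≤ K)
    (hR : tsupport φ ⊆ Metric.ball 0 R) (p : Euc N →ᵇ ℂ) (hw : AEStronglyMeasurable w) {c : ℝ}
    (hc : c ≠ 0) :
    ‖∫ x in Ω, u x * (φ x * (p (c • x) * w (c • x)))‖ₑ ≤ eLpNorm u 2 (volume.restrict Ω) *
      ((K * ‖p‖₊ : ℝ≥0) *
        eLpNorm (fun x => w (c • x)) 2 (volume.restrict (Metric.ball 0 R))) := by
  have hmeas : AEStronglyMeasurable (fun x => φ x * (p (c • x) * w (c • x))) :=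
    hφ.aestronglyMeasurable.mul ((aestronglyMeasurable_comp_smul
      p.continuous.aestronglyMeasurable hc).mul (aestronglyMeasurable_comp_smul hw hc))
  refine (enorm_integral_le_lintegral_enorm _).trans ?_
  rw [← eLpNorm_one_eq_lintegral_enorm]
  have h := eLpNorm_smul_le_mul_eLpNorm (p := 2) (q := 2) (r := 1) hmeas.restrict
    hu.aestronglyMeasurable
  refine (show _ ≤ _ from h).trans ?_
  gcongr
  have hsupp : Function.support (fun x => φ x * (p (c • x) * w (c • x))) ⊆ Metric.ball 0 R :=
    (Function.support_mul_subset_left _ _).trans ((subset_tsupport φ).trans hR)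
  refine (eLpNorm_mono_measure _ Measure.restrict_le_self).trans ?_
  rw [← eLpNorm_restrict_eq_of_support_subset hsupp]
  refine eLpNorm_le_nnreal_smul_eLpNorm_of_ae_le_mul (Eventually.of_forall fun x => ?_) 2
  rw [nnnorm_mul, nnnorm_mul, ← mul_assoc]
  gcongr
  · exact hK x
  · exact p.nnnorm_coe_le_nnnorm _

/-- Two-scale convergence is stable under multiplication by oscillating multipliers. -/
lemma TrigTendsto.mul_multiplier {Ω : Set (Euc N)} {ε : ℕ → ℝ} (hpos : ∀ n, 0 < ε n)
    (hε : Tendsto ε atTop (𝓝 0)) {u : ℕ → Euc N → ℂ} {v : Euc N → Besicovitch N}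
    (hu : BoundedL2 Ω u) (hv : MemLp v 2 (volume.restrict Ω)) (h : TrigTendsto Ω ε u v)
    {m : Euc N → ℂ} (hm : IsMultiplier m) :
    TrigTendsto Ω ε (fun n x => m ((ε n)⁻¹ • x) * u n x) fun x => Besicovitch.mul hm (v x) := by
  intro φ hφ hφc hφΩ p hp
  have hε0 : ∀ n, (ε n)⁻¹ ≠ 0 := fun n => inv_ne_zero (hpos n).ne'
  obtain ⟨hu2, U, hU⟩ := hu
  obtain ⟨C, hC⟩ := hm.bounded
  have hmm : AEStronglyMeasurable m := LocL2.aestronglyMeasurable hm.besicovitch.locL2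
  obtain ⟨R, hRpos, hR⟩ := hφc.isCompact.isBounded.subset_ball_lt 0 (0 : Euc N)
  obtain ⟨K', hK'⟩ := hφ.bounded_above_of_compact_support hφc
  have hK : ∀ x, ‖φ x‖₊ ≤ K'.toNNReal := fun x => by
    rw [← NNReal.coe_le_coe]
    exact (hK' x).trans (Real.le_coe_toNNReal _)
  obtain ⟨D, hD, hDb⟩ := exists_eventually_eLpNorm_comp_smul_le N hpos hε hRpos
  have hφv : ∫⁻ x in Ω, ‖φ x‖ₑ * ‖v x‖ₑ ≠ ∞ := by
    have hvn : MemLp (fun x => ‖v x‖) 2 (volume.restrict Ω) :=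
      hv.of_enorm_le_mul (c := 1) hv.aestronglyMeasurable.norm
        (Eventually.of_forall fun x => by simp)
    have hi := (hφ.memLp_of_hasCompactSupport (p := 2) (μ := volume.restrict Ω) hφc).norm.integrable_mul hvn
    have := hi.2
    simp only [HasFiniteIntegral, Pi.mul_apply, enorm_mul, enorm_norm] at this
    exact this.ne
  -- `C1` bounds the error in the oscillating integrals and `C2` the error in the limit; neither
  -- involves the polynomial `q` that will replace `m`.
  set C1 : ℝ≥0∞ := U * ((K'.toNNReal * ‖p‖₊ : ℝ≥0) * D) with hC1
  set C2 : ℝ≥0∞ := ‖p‖₊ * ∫⁻ x in Ω, ‖φ x‖ₑ * ‖v x‖ₑ with hC2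
  have hC12 : C1 + C2 ≠ ∞ := ENNReal.add_ne_top.2
    ⟨ENNReal.mul_ne_top (by simp) (ENNReal.mul_ne_top ENNReal.coe_ne_top hD),
      ENNReal.mul_ne_top (by simp) hφv⟩
  have hpb : ∀ᵐ y : Euc N, ‖p y‖₊ ≤ ‖p‖₊ := Eventually.of_forall p.nnnorm_coe_le_nnnorm
  refine tendsto_of_enorm_approx hC12 fun η hη hηt => ?_
  -- With `q` in place of `m`, the oscillating factor `q` moves into the test function, where `p *
  -- q` is again a trigonometric polynomial.
  obtain ⟨q, hq, hlt⟩ := hm.besicovitch.exists_trig hη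
  refine ⟨_, _, h φ hφ hφc hφΩ (p * q) (mul_mem_trig hp hq), ?_, ?_⟩
  · filter_upwards [hDb _ η hlt] with n hn
    have hi1 : Integrable (fun x => m ((ε n)⁻¹ • x) * u n x * (φ x * p ((ε n)⁻¹ • x)))
        (volume.restrict Ω) :=
      integrable_mul_trig (memLp_mul_bounded (hu2 n)
        (aestronglyMeasurable_comp_smul hmm (hε0 n)).restrict
        (ae_restrict_of_ae (ae_comp_smul hC (hε0 n)))) hφ hφc p (hε0 n)
    rw [← integral_sub hi1 (integrable_mul_trig (hu2 n) hφ hφc (p * q) (hε0 n))]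
    have hI : ∀ x, m ((ε n)⁻¹ • x) * u n x * (φ x * p ((ε n)⁻¹ • x)) -
        u n x * (φ x * (p * q) ((ε n)⁻¹ • x)) =
        u n x * (φ x * (p ((ε n)⁻¹ • x) * (m - fun y => q y) ((ε n)⁻¹ • x))) := by
      intro x
      simp only [BoundedContinuousFunction.mul_apply, Pi.sub_apply]
      ring
    simp only [hI]
    refine (enorm_integral_osc_le (hu2 n) hφ hK hR p
      (hmm.sub q.continuous.aestronglyMeasurable) (hε0 n)).trans ?_
    calc _ ≤ (U : ℝ≥0∞) * ((K'.toNNReal * ‖p‖₊ : ℝ≥0) * (D * η)) := by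
          gcongr
          exact hU n
      _ = C1 * η := by rw [hC1]; ring
      _ ≤ (C1 + C2) * η := by gcongr; exact le_self_add
  · have hsub := integral_sub (integrable_test_meanValue (memLp_besicovitch_mul hv hm) hφ hφc
      (isMultiplier_trig hp)) (integrable_test_meanValue hv hφ hφc
      (isMultiplier_trig (mul_mem_trig hp hq)))
    refine (congrArg _ hsub.symm).trans_le ?_
    refine (enorm_integral_le_lintegral_enorm _).trans ?_
    have hpt : ∀ x, ‖φ x * (meanValue fun y => p y * Besicovitch.mul hm (v x) y) -
        φ x * meanValue fun y => (p * q) y * v x y‖ₑ ≤ (‖p‖₊ * η) * (‖φ x‖ₑ * ‖v x‖ₑ) := by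
      intro x
      have hpv := (isMultiplier_trig hp).isBesicovitch_mul (v x).isBesicovitch
      have h1 := enorm_meanValue_mul_le (hm.sub_trig hq) hpv
      have h2 := meanValue_sub ((isMultiplier_trig hp).isBesicovitch_mul
        (Besicovitch.mul hm (v x)).isBesicovitch)
        ((isMultiplier_trig (mul_mem_trig hp hq)).isBesicovitch_mul (v x).isBesicovitch)
      have h3 : (fun y => (m y - q y) * ((fun y => p y) * (v x : Euc N → ℂ)) y) =
          (fun y => p y) * (Besicovitch.mul hm (v x) : Euc N → ℂ) -
            (fun y => (p * q) y) * (v x : Euc N → ℂ) := by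
        funext y
        rw [Besicovitch.coe_mul]
        simp only [Pi.mul_apply, Pi.sub_apply, BoundedContinuousFunction.mul_apply]
        ring
      rw [h3, h2] at h1
      rw [← mul_sub, enorm_mul]
      calc _ ≤ ‖φ x‖ₑ * (η * (‖p‖₊ * ‖v x‖ₑ)) := by
            gcongr
            rw [Besicovitch.enorm_eq]
            refine (show _ ≤ _ from h1).trans ?_
            gcongr
            · exact hlt.le
            · exact besNorm_mul_le hpb
        _ = _ := by ring
    refine (lintegral_mono hpt).trans ?_
    rw [lintegral_const_mul' _ _ (ENNReal.mul_ne_top (by simp) hηt)]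
    calc _ = C2 * η := by rw [hC2]; ring
      _ ≤ (C1 + C2) * η := by gcongr; exact le_add_self

/-! ### The divergence of a two-scale limit -/

lemma hasFDerivAt_char_smul (ζ : Euc N) (c : ℝ) (x : Euc N) :
    HasFDerivAt (fun x : Euc N => BoundedContinuousFunction.innerProbChar ζ (c • x))
      (BoundedContinuousFunction.innerProbChar ζ (c • x) •
        (Complex.I • Complex.ofRealCLM.comp (innerSL ℝ (c • ζ)))) x := by
  have h := (Complex.I • Complex.ofRealCLM.comp (innerSL ℝ (c • ζ))).hasFDerivAt (x := x) |>.cexp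
  have e : ∀ x : Euc N, BoundedContinuousFunction.innerProbChar ζ (c • x) =
      Complex.exp ((Complex.I • Complex.ofRealCLM.comp (innerSL ℝ (c • ζ))) x) := by
    intro x
    rw [BoundedContinuousFunction.innerProbChar_apply]
    congr 1
    simp only [smul_apply, ContinuousLinearMap.comp_apply, innerSL_apply_apply,
      Complex.ofRealCLM_apply, smul_eq_mul, real_inner_smul_left, real_inner_comm x ζ]
    ring
  simp only [e]
  exact h

lemma fderiv_mul_char {φ : Euc N → ℂ} (hφ : Differentiable ℝ φ) (ζ : Euc N) (c : ℝ) (x : Euc N)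
    (k : Fin N) :
    fderiv ℝ (fun x => φ x * BoundedContinuousFunction.innerProbChar ζ (c • x)) x
        (EuclideanSpace.single k 1) =
      fderiv ℝ φ x (EuclideanSpace.single k 1) *
          BoundedContinuousFunction.innerProbChar ζ (c • x) +
        (c * (Complex.I * ζ k)) * (φ x * BoundedContinuousFunction.innerProbChar ζ (c • x)) := by
  have h := (hφ x).hasFDerivAt.mul (hasFDerivAt_char_smul ζ c x)
  rw [HasFDerivAt.fderiv (f := fun x => φ x * _) h]
  simp only [add_apply, smul_apply,
    ContinuousLinearMap.comp_apply, innerSL_apply_apply, Complex.ofRealCLM_apply, smul_eq_mul,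
    EuclideanSpace.inner_single_right]
  simp
  ring

lemma contDiff_char_smul (ζ : Euc N) (c : ℝ) : ContDiff ℝ (⊤ : ℕ∞)
    fun x : Euc N => BoundedContinuousFunction.innerProbChar ζ (c • x) := by
  simp only [BoundedContinuousFunction.innerProbChar_apply]
  have h : ContDiff ℝ (⊤ : ℕ∞) fun x : Euc N => inner ℝ (c • x) ζ :=
    (contDiff_id.const_smul c).inner ℝ contDiff_const
  exact ((Complex.ofRealCLM.contDiff.comp h).mul contDiff_const).cexp

lemma norm_char (ζ y : Euc N) : ‖BoundedContinuousFunction.innerProbChar ζ y‖ = 1 := by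
  rw [BoundedContinuousFunction.innerProbChar_apply, Complex.norm_exp_ofReal_mul_I]

/-- Characters have modulus one, so Cauchy–Schwarz bounds the integrals by a constant independent of
`n`. -/
lemma tendsto_eps_mul_integral {Ω : Set (Euc N)} {ε : ℕ → ℝ} (hε : Tendsto ε atTop (𝓝 0))
    {d : ℕ → Euc N → ℂ} (hd : BoundedL2 Ω d) {φ : Euc N → ℂ} (hφ : Continuous φ)
    (hφc : HasCompactSupport φ) (ζ : Euc N) :
    Tendsto (fun n => (ε n : ℂ) * ∫ x in Ω, d n x *
      (φ x * BoundedContinuousFunction.innerProbChar ζ ((ε n)⁻¹ • x))) atTop (𝓝 0) := by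
  obtain ⟨hd2, C, hC⟩ := hd
  have hφ2 := hφ.memLp_of_hasCompactSupport (p := 2) (μ := volume.restrict Ω) hφc
  have hbound : ∀ n, ‖∫ x in Ω, d n x *
      (φ x * BoundedContinuousFunction.innerProbChar ζ ((ε n)⁻¹ • x))‖ ≤
        (C * eLpNorm φ 2 (volume.restrict Ω)).toReal := by
    intro n
    rw [← toReal_enorm]
    refine ENNReal.toReal_mono (ENNReal.mul_ne_top (by simp) hφ2.2.ne) ?_
    refine (enorm_integral_le_lintegral_enorm _).trans ?_
    have h := eLpNorm_smul_le_mul_eLpNorm (p := 2) (q := 2) (r := 1) hφ2.aestronglyMeasurable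
      (hd2 n).aestronglyMeasurable
    rw [eLpNorm_one_eq_lintegral_enorm] at h
    refine le_trans (le_of_eq ?_) (h.trans ?_)
    · refine lintegral_congr fun x => ?_
      rw [enorm_mul, enorm_mul, Pi.smul_apply', smul_eq_mul, enorm_mul]
      congr 1
      rw [← ofReal_norm (BoundedContinuousFunction.innerProbChar ζ _), norm_char]
      simp
    · gcongr
      exact hC n
  refine squeeze_zero_norm (a := fun n => |ε n| * (C * eLpNorm φ 2 (volume.restrict Ω)).toReal)
    (fun n => ?_) ?_
  · rw [norm_mul, Complex.norm_real, Real.norm_eq_abs]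
    exact mul_le_mul_of_nonneg_left (hbound n) (abs_nonneg _)
  · simpa using hε.abs.mul_const (C * eLpNorm φ 2 (volume.restrict Ω)).toReal

/-- The two-scale limit of the weak divergence identity tested with `φ(x) e_ζ(x/ε_n)` and multiplied
by `ε_n`: only the derivatives of the character, of size `1/ε_n`, contribute. -/
lemma sum_integral_eq_zero {Ω : Set (Euc N)} {ε : ℕ → ℝ} (hpos : ∀ n, 0 < ε n)
    (hε : Tendsto ε atTop (𝓝 0)) (σ : Fin 3 → Fin N) {u : ℕ → Euc N → Fin 3 → ℂ}
    (hu : ∀ n j, MemLp (fun x => u n x j) 2 (volume.restrict Ω)) (hdiv : BoundedDiv σ Ω u)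
    {v : Euc N → Fin 3 → Besicovitch N}
    (h : ∀ j, TrigTendsto Ω ε (fun n x => u n x j) fun x => v x j)
    {φ : Euc N → ℂ} (hφ : ContDiff ℝ (⊤ : ℕ∞) φ) (hφc : HasCompactSupport φ)
    (hφΩ : tsupport φ ⊆ Ω) (ζ : Euc N) :
    ∑ j, (Complex.I * ζ (σ j)) * ∫ x in Ω, φ x *
      meanValue (fun y => BoundedContinuousFunction.innerProbChar ζ y * v x j y) = 0 := by
  obtain ⟨d, hd, hdw⟩ := hdiv
  set E := BoundedContinuousFunction.innerProbChar ζ with hE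
  have hφd : Differentiable ℝ φ := hφ.differentiable (by simp)
  let D : Fin 3 → Euc N → ℂ := fun j x => fderiv ℝ φ x (EuclideanSpace.single (σ j) 1)
  have hD : ∀ j, Continuous (D j) := fun j =>
    (hφ.continuous_fderiv (by simp)).clm_apply continuous_const
  have hDc : ∀ j, HasCompactSupport (D j) := fun j => hφc.fderiv_apply ℝ _
  have hDΩ : ∀ j, tsupport (D j) ⊆ Ω := fun j => (tsupport_fderiv_apply_subset ℝ _).trans hφΩ
  have hεc : Tendsto (fun n => (ε n : ℂ)) atTop (𝓝 0) := by
    simpa [Function.comp_def] using (Complex.continuous_ofReal.tendsto 0).comp hε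
  have hL := tendsto_finsetSum Finset.univ fun j _ =>
    (h j φ hφ.continuous hφc hφΩ E (char_mem_trig ζ)).const_mul (Complex.I * ζ (σ j))
  refine tendsto_nhds_unique hL ?_
  -- The sums in `hL` are also equal to minus `ε_n` times the divergence integral and the integrals
  -- with derivatives of `φ`. The former are bounded and the latter converge, so the total tends to
  -- zero.
  have hR1 := tendsto_eps_mul_integral hε hd hφ.continuous hφc ζ
  have hR2 := hεc.mul (tendsto_finsetSum Finset.univ fun j _ =>
    h j (D j) (hD j) (hDc j) (hDΩ j) E (char_mem_trig ζ))
  have hR := (hR1.add hR2).neg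
  rw [zero_mul, add_zero, neg_zero] at hR
  refine hR.congr fun n => ?_
  have hc : (ε n)⁻¹ ≠ 0 := inv_ne_zero (hpos n).ne'
  have hε0 : (ε n : ℂ) ≠ 0 := by exact_mod_cast (hpos n).ne'
  have hw := hdw n (fun x => φ x * E ((ε n)⁻¹ • x)) (hφ.mul (contDiff_char_smul ζ _))
    hφc.mul_right (tsupport_mul_subset_left.trans hφΩ)
  have hint1 : ∀ j, Integrable (fun x => u n x j * (D j x * E ((ε n)⁻¹ • x)))
      (volume.restrict Ω) := fun j => integrable_mul_trig (hu n j) (hD j) (hDc j) E hc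
  have hint2 : ∀ j, Integrable (fun x => ((ε n)⁻¹ : ℝ) * (Complex.I * ζ (σ j)) *
      (u n x j * (φ x * E ((ε n)⁻¹ • x)))) (volume.restrict Ω) := fun j =>
    (integrable_mul_trig (hu n j) hφ.continuous hφc E hc).const_mul _
  have hexp : ∀ x, ∑ j, u n x j * fderiv ℝ (fun x => φ x * E ((ε n)⁻¹ • x)) x
      (EuclideanSpace.single (σ j) 1) = ∑ j, (u n x j * (D j x * E ((ε n)⁻¹ • x)) +
        ((ε n)⁻¹ : ℝ) * (Complex.I * ζ (σ j)) * (u n x j * (φ x * E ((ε n)⁻¹ • x)))) := by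
    intro x
    refine Finset.sum_congr rfl fun j _ => ?_
    rw [fderiv_mul_char hφd]
    ring
  simp only [hexp] at hw
  simp only [Finset.sum_add_distrib] at hw
  rw [integral_add (integrable_finsetSum _ fun j _ => hint1 j)
    (integrable_finsetSum _ fun j _ => hint2 j), integral_finsetSum _ fun j _ => hint1 j,
    integral_finsetSum _ fun j _ => hint2 j] at hw
  simp only [integral_const_mul] at hw
  rw [← neg_eq_iff_eq_neg] at hw
  rw [← hw]
  push_cast
  simp only [mul_assoc, ← Finset.mul_sum]
  field_simp
  ring

/-- If the divergences of `u_n` are bounded in `L²`, the two-scale limit is divergence free in the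
fast variable. -/
lemma ae_formalDiv_limit_eq_zero {Ω : Set (Euc N)} (hΩ : IsOpen Ω) {ε : ℕ → ℝ}
    (hpos : ∀ n, 0 < ε n) (hε : Tendsto ε atTop (𝓝 0)) (σ : Fin 3 → Fin N)
    {u : ℕ → Euc N → Fin 3 → ℂ} (hu : ∀ n j, MemLp (fun x => u n x j) 2 (volume.restrict Ω))
    (hdiv : BoundedDiv σ Ω u) {v : Euc N → Fin 3 → Besicovitch N}
    (hv : ∀ j, MemLp (fun x => v x j) 2 (volume.restrict Ω))
    (h : ∀ j, TrigTendsto Ω ε (fun n x => u n x j) fun x => v x j) :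
    ∀ᵐ x ∂(volume.restrict Ω), formalDiv σ (fun j => v x j) = 0 := by
  refine ae_formalDiv_eq_zero σ (fun j => (hv j).aestronglyMeasurable) fun ξ => ?_
  have hmul : IsMultiplier fun y => BoundedContinuousFunction.innerProbChar (-ξ) y :=
    isMultiplier_trig (char_mem_trig (-ξ))
  have hmem : MemLp (fun x => formalDiv σ (fun j => v x j) ξ) 2 (volume.restrict Ω) := by
    simp only [formalDiv, fourierCoeff_eq]
    exact memLp_finsetSum _ fun j _ => (memLp_meanValue_mul (hv j) hmul).const_mul _
  have hloc : LocallyIntegrableOn (fun x => formalDiv σ (fun j => v x j) ξ) Ω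
      (volume.restrict Ω) := (hmem.locallyIntegrable one_le_two).locallyIntegrableOn _
  -- The fundamental lemma of the calculus of variations, at a fixed frequency and with real test
  -- functions.
  have key := hΩ.ae_eq_zero_of_integral_contDiff_smul_eq_zero hloc fun g hg hgc hgΩ => ?_
  · filter_upwards [key, ae_restrict_mem hΩ.measurableSet] with x hx hxΩ using hx hxΩ
  have hφ : ContDiff ℝ (⊤ : ℕ∞) fun x => (g x : ℂ) := Complex.ofRealCLM.contDiff.comp hg
  have hφc : HasCompactSupport fun x => (g x : ℂ) :=
    hgc.comp_left (g := fun t : ℝ => (t : ℂ)) Complex.ofReal_zero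
  have hφΩ : tsupport (fun x => (g x : ℂ)) ⊆ Ω := by
    refine (closure_mono fun x hx => ?_).trans hgΩ
    simpa using hx
  -- Testing with `e_{-ξ}` extracts the coefficient at `ξ`; the factor `-ξ` it produces accounts for
  -- the sign below.
  have hz := sum_integral_eq_zero hpos hε σ hu hdiv h hφ hφc hφΩ (-ξ)
  have hint : ∀ j, Integrable (fun x => Complex.I * ξ (σ j) * ((g x : ℂ) *
      meanValue fun y => BoundedContinuousFunction.innerProbChar (-ξ) y * v x j y))
      (volume.restrict Ω) := fun j =>
    (integrable_test_meanValue (hv j) hφ.continuous hφc hmul).const_mul _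
  calc ∫ x in Ω, g x • formalDiv σ (fun j => v x j) ξ
      = ∫ x in Ω, ∑ j, Complex.I * ξ (σ j) * ((g x : ℂ) *
          meanValue fun y => BoundedContinuousFunction.innerProbChar (-ξ) y * v x j y) := by
        refine integral_congr_ae (Eventually.of_forall fun x => ?_)
        simp only [formalDiv, fourierCoeff_eq, Complex.real_smul, Finset.mul_sum]
        exact Finset.sum_congr rfl fun j _ => by ring
    _ = -∑ j, (Complex.I * (-ξ) (σ j)) * ∫ x in Ω, (g x : ℂ) *
          meanValue fun y => BoundedContinuousFunction.innerProbChar (-ξ) y * v x j y := by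
        rw [integral_finsetSum _ fun j _ => hint j, ← Finset.sum_neg_distrib]
        refine Finset.sum_congr rfl fun j _ => ?_
        rw [integral_const_mul]
        simp
    _ = 0 := by
        rw [← neg_zero, neg_inj]
        simpa using hz

/-! ### The space-time cylinder, vector components and the coefficient matrix -/

lemma isOpen_timeSpace (T : ℝ) : IsOpen (timeSpace T) := by
  have h : Continuous fun z : Euc 4 => z 0 := by fun_prop
  exact (isOpen_lt continuous_const h).inter (isOpen_lt h continuous_const)

lemma BoundedL2.component {Ω : Set (Euc N)} {u : ℕ → Euc N → Fin 3 → ℂ} (hu : BoundedL2 Ω u)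
    {j : Fin 3} (hj : ∀ n, MemLp (fun x => u n x j) 2 (volume.restrict Ω)) :
    BoundedL2 Ω fun n x => u n x j := by
  obtain ⟨-, C, hC⟩ := hu
  exact ⟨hj, C, fun n => (eLpNorm_mono fun x => norm_le_pi_norm (u n x) j).trans (hC n)⟩

lemma IsCoefficient.isMultiplier {P : Euc 3 → Matrix (Fin 3) (Fin 3) ℂ} (hP : IsCoefficient P)
    (i j : Fin 3) : IsMultiplier fun y => P y i j :=
  isMultiplier_of_periodic (hP.bounded i j) fun k y => by rw [hP.periodic]

/-- The equality holds at every `y`, so the result for the limit in the abstract space is literally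
a statement about the field `P Ê⁰(x,·)`. -/
lemma IsCoefficient.coe_sum_mul {P : Euc 3 → Matrix (Fin 3) (Fin 3) ℂ} (hP : IsCoefficient P)
    (w : Fin 3 → Besicovitch 3) (i : Fin 3) :
    ((∑ j, Besicovitch.mul (hP.isMultiplier i j) (w j) : Besicovitch 3) : Euc 3 → ℂ) =
      fun y => (P y).mulVec (fun j => w j y) i := by
  rw [Besicovitch.coe_sum]
  funext y
  simp only [Finset.sum_apply, Matrix.mulVec, dotProduct, Besicovitch.coe_mul, Pi.mul_apply]

end TwoScaleMaxwell

theorem proposition3p1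
    (T : ℝ) (hT : 0 < T)
    (ε : ℕ → ℝ) (hε_pos : ∀ n, 0 < ε n) (hε : Tendsto ε atTop (𝓝 0))
    (P : Euc 3 → Matrix (Fin 3) (Fin 3) ℂ) (hP : IsCoefficient P)
    (f g : ℕ → Euc 4 → Fin 3 → ℂ) (B0 E0 : ℕ → Euc 3 → Fin 3 → ℂ)
    (hf : BoundedL2 (timeSpace T) f) (hg : BoundedL2 (timeSpace T) g)
    (hB0 : BoundedL2 univ B0) (hE0 : BoundedL2 univ E0)
    (hdivf : BoundedDiv Fin.succ (timeSpace T) f)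
    (hdivg : BoundedDiv Fin.succ (timeSpace T) g)
    (hdivE0 : BoundedDiv id univ fun n x => (P ((ε n)⁻¹ • x)).mulVec (E0 n x))
    (hdivB0 : BoundedDiv id univ B0)
    (fhat ghat : Euc 4 → Fin 3 → Besicovitch 4)
    (B0hat E0hat : Euc 3 → Fin 3 → Besicovitch 3)
    (hfhat : ∀ j, TwoScaleTendsto (timeSpace T) ε (fun n z => f n z j) fun z => fhat z j)
    (hghat : ∀ j, TwoScaleTendsto (timeSpace T) ε (fun n z => g n z j) fun z => ghat z j)
    (hB0hat : ∀ j, TwoScaleTendsto univ ε (fun n x => B0 n x j) fun x => B0hat x j)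
    (hE0hat : ∀ j, TwoScaleTendsto univ ε (fun n x => E0 n x j) fun x => E0hat x j) :
    (∀ᵐ z ∂(volume.restrict (timeSpace T)), formalDiv Fin.succ (fun j => fhat z j) = 0) ∧
    (∀ᵐ z ∂(volume.restrict (timeSpace T)), formalDiv Fin.succ (fun j => ghat z j) = 0) ∧
    (∀ᵐ x : Euc 3, formalDiv id (fun j => B0hat x j) = 0) ∧
    (∀ᵐ x : Euc 3,
      (∀ i, IsBesicovitch fun y => (P y).mulVec (fun j => E0hat x j y) i) ∧
      formalDiv id (fun i y => (P y).mulVec (fun j => E0hat x j y) i) = 0) := by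
  have hcomp : ∀ i j n, MemLp (fun x => P ((ε n)⁻¹ • x) i j * E0 n x j) 2
      (volume.restrict univ) := by
    intro i j n
    obtain ⟨C, hC⟩ := (hP.isMultiplier i j).bounded
    have hc : (ε n)⁻¹ ≠ 0 := inv_ne_zero (hε_pos n).ne'
    exact memLp_mul_bounded ((hE0hat j).memLp n)
      (aestronglyMeasurable_comp_smul (hP.bounded i j).aestronglyMeasurable hc).restrict
      (ae_restrict_of_ae (ae_comp_smul hC hc))
  have hmul : ∀ i j, MemLp (fun x => Besicovitch.mul (hP.isMultiplier i j) (E0hat x j)) 2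
      (volume.restrict univ) := fun i j => memLp_besicovitch_mul (hE0hat j).memLp_limit _
  -- The limit of the flux is identified entry by entry: each product `P_{ij}(x/ε_n) E⁰_{n,j}`
  -- converges separately, and the sum over `j` is taken afterwards.
  have hlim : ∀ i, TrigTendsto univ ε (fun n x => (P ((ε n)⁻¹ • x)).mulVec (E0 n x) i)
      fun x => ∑ j, Besicovitch.mul (hP.isMultiplier i j) (E0hat x j) := fun i =>
    TrigTendsto.sum hε_pos Finset.univ (hcomp i) (hmul i) fun j =>
      (hE0hat j).trigTendsto.mul_multiplier hε_pos hε (hE0.component (hE0hat j).memLp)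
        (hE0hat j).memLp_limit (hP.isMultiplier i j)
  have hB := ae_formalDiv_limit_eq_zero isOpen_univ hε_pos hε id (fun n j => (hB0hat j).memLp n)
    hdivB0 (fun j => (hB0hat j).memLp_limit) fun j => (hB0hat j).trigTendsto
  have hPE : ∀ n i, MemLp (fun x => (P ((ε n)⁻¹ • x)).mulVec (E0 n x) i) 2
      (volume.restrict univ) := by
    intro n i
    simp only [Matrix.mulVec, dotProduct]
    exact memLp_finsetSum Finset.univ fun j _ => hcomp i j n
  have hPEhat : ∀ i, MemLp (fun x => ∑ j, Besicovitch.mul (hP.isMultiplier i j) (E0hat x j)) 2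
      (volume.restrict univ) := fun i => memLp_besicovitch_sum Finset.univ (hmul i)
  have hE := ae_formalDiv_limit_eq_zero (u := fun n x => (P ((ε n)⁻¹ • x)).mulVec (E0 n x))
    (v := fun x i => ∑ j, Besicovitch.mul (hP.isMultiplier i j) (E0hat x j)) isOpen_univ hε_pos hε
    id hPE hdivE0 hPEhat hlim
  rw [Measure.restrict_univ] at hB hE
  refine ⟨?_, ?_, hB, hE.mono fun x hx => ⟨fun i => ?_, ?_⟩⟩
  · exact ae_formalDiv_limit_eq_zero (isOpen_timeSpace T) hε_pos hε Fin.succ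
      (fun n j => (hfhat j).memLp n) hdivf (fun j => (hfhat j).memLp_limit)
      fun j => (hfhat j).trigTendsto
  · exact ae_formalDiv_limit_eq_zero (isOpen_timeSpace T) hε_pos hε Fin.succ
      (fun n j => (hghat j).memLp n) hdivg (fun j => (hghat j).memLp_limit)
      fun j => (hghat j).trigTendsto
  · rw [← hP.coe_sum_mul (E0hat x) i]
    exact Besicovitch.isBesicovitch _
  · have h := hx
    simp only [hP.coe_sum_mul (E0hat x)] at h
    exact h
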